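/- Let $k$ be a field and let $H$ be a Hopf algebra over $k$ with coproduct $\Delta$. Let $G(H)$ be the group of group-like elements of $H$. The coradical filtration of $H$ is given by letting $H_0$ be the sum of all simple subcoalgebras of $H$ and $H_n=\Delta^{-1}(H\otimes H_{n-1}+H_0\otimes H)$ for $n\ge 1$; put $H_{-1}=0$. Assume that $H$ is pointed, i.e. $H_0=kG(H)$, and let $\operatorname{gr}H=\bigoplus_{n\ge 0}H_n/H_{n-1}$ be the associated graded Hopf algebra, with the structure induced by that of $H$. Denote its antipode by $S_{\operatorname{gr}H}$, and let the order $|S_{\operatorname{gr}H}|\in\{1,2,\dots\}\cup\{\infty\}$ be the least $n\ge 1$ with $S_{\operatorname{gr}H}^{\,n}=\mathrm{id}$ ($\infty$ if there is none). For a Hopf algebra $A$ over $k$ and $x\in G(A)$ let $P_{x,1}(A)=\{h\in A:\Delta(h)=h\otimes x+1\otimes h\}$, on which the cyclic group $\langle x\rangle$ acts by conjugation, let $C_{\langle x\rangle}(P_{x,1}(A))$ be the subgroup of those elements of $\langle x\rangle$ that act trivially, and let $a_x=|\langle x\rangle:C_{\langle x\rangle}(P_{x,1}(A))|$. Define $m_A=\operatorname{lcm}\{a_x:x\in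 G(A)\}$, that is, the least positive integer divisible by all the $a_x$; $m_A=\infty$ if some $a_x$ is infinite or if no such integer exists. If $m_H<\infty$, then $m_{\operatorname{gr}H}<\infty$, and either $S_{\operatorname{gr}H}=\mathrm{id}$ or $|S_{\operatorname{gr}H}|=2m_{\operatorname{gr}H}$. -/

import Mathlib

noncomputable section

namespace PointedHopf

open scoped TensorProduct

section LinearAlgebra

variable {k : Type*} [Field k]
variable {V W V' W' : Type*} [AddCommGroup V] [Module k V] [AddCommGroup W] [Module k W]
  [AddCommGroup V'] [Module k V'] [AddCommGroup W'] [Module k W']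

/-- `A ⊗ B` as a subspace of `V ⊗ W`: the span of all `a ⊗ b` with `a ∈ A` and `b ∈ B`. -/
def tensorSub (A : Submodule k V) (B : Submodule k W) : Submodule k (V ⊗[k] W) :=
  Submodule.map₂ (TensorProduct.mk k V W) A B

theorem tmul_mem_tensorSub {A : Submodule k V} {B : Submodule k W} {a : V} {b : W}
    (ha : a ∈ A) (hb : b ∈ B) : a ⊗ₜ[k] b ∈ tensorSub A B :=
  Submodule.apply_mem_map₂ _ ha hb

theorem tensorSub_le {A : Submodule k V} {B : Submodule k W} {P : Submodule k (V ⊗[k] W)} :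
    tensorSub A B ≤ P ↔ ∀ a ∈ A, ∀ b ∈ B, a ⊗ₜ[k] b ∈ P :=
  Submodule.map₂_le

theorem tensorSub_mono {A A' : Submodule k V} {B B' : Submodule k W} (hA : A ≤ A') (hB : B ≤ B') :
    tensorSub A B ≤ tensorSub A' B' :=
  Submodule.map₂_le_map₂ hA hB

theorem tensorSub_top_top : tensorSub (⊤ : Submodule k V) (⊤ : Submodule k W) = ⊤ :=
  TensorProduct.map₂_mk_top_top_eq_top k V W

theorem map_mem_tensorSub {f : V →ₗ[k] V'} {g : W →ₗ[k] W'} {A : Submodule k V}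
    {B : Submodule k W} {A' : Submodule k V'} {B' : Submodule k W'}
    (hf : ∀ a ∈ A, f a ∈ A') (hg : ∀ b ∈ B, g b ∈ B') {z : V ⊗[k] W} (hz : z ∈ tensorSub A B) :
    TensorProduct.map f g z ∈ tensorSub A' B' := by
  have : tensorSub A B ≤ (tensorSub A' B').comap (TensorProduct.map f g) :=
    tensorSub_le.2 fun a ha b hb => tmul_mem_tensorSub (hf a ha) (hg b hb)
  exact this hz

theorem ker_map (f : V →ₗ[k] V') (g : W →ₗ[k] W') :
    LinearMap.ker (TensorProduct.map f g) =
      tensorSub (LinearMap.ker f) ⊤ ⊔ tensorSub ⊤ (LinearMap.ker g) := by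
  have h1 : TensorProduct.map f g =
      (TensorProduct.map (LinearMap.range f).subtype (LinearMap.range g).subtype) ∘ₗ
        TensorProduct.map f.rangeRestrict g.rangeRestrict := by
    rw [← TensorProduct.map_comp]; rfl
  have h2 : LinearMap.ker
      (TensorProduct.map (LinearMap.range f).subtype (LinearMap.range g).subtype) = ⊥ :=
    LinearMap.ker_eq_bot.2 (Module.Flat.tensorProduct_mapIncl_injective_of_right _ _)
  rw [h1, LinearMap.ker_comp_of_ker_eq_bot _ h2,
    TensorProduct.map_ker (f := (LinearMap.ker f).subtype) (f' := (LinearMap.ker g).subtype)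
      (by rw [LinearMap.exact_iff]; simp) f.surjective_rangeRestrict
      (by rw [LinearMap.exact_iff]; simp) g.surjective_rangeRestrict, sup_comm]
  congr 1
  · rw [LinearMap.rTensor, TensorProduct.range_map]; simp [tensorSub]
  · rw [LinearMap.lTensor, TensorProduct.range_map]; simp [tensorSub]

theorem exists_proj (B : Submodule k W) :
    ∃ e : W →ₗ[k] W, (∀ b ∈ B, e b = b) ∧ ∀ w, e w ∈ B := by
  obtain ⟨g, hg⟩ := LinearMap.exists_leftInverse_of_injective B.subtype (by simp)
  refine ⟨B.subtype ∘ₗ g, fun b hb => ?_, fun w => (g w).2⟩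
  have := LinearMap.congr_fun hg ⟨b, hb⟩
  simpa using congrArg Subtype.val this

theorem lTensor_eq_self {B : Submodule k W} {e : W →ₗ[k] W} (he : ∀ b ∈ B, e b = b)
    {z : V ⊗[k] W} (hz : z ∈ tensorSub ⊤ B) : e.lTensor V z = z := by
  have : tensorSub (⊤ : Submodule k V) B ≤ LinearMap.eqLocus (e.lTensor V) LinearMap.id :=
    tensorSub_le.2 fun a _ b hb => by simp [LinearMap.mem_eqLocus, he b hb]
  simpa [LinearMap.mem_eqLocus] using this hz

theorem mem_of_mem_of_mem {F : Submodule k V} {G G' : Submodule k W} (hG : G' ≤ G)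
    {z : V ⊗[k] W} (h1 : z ∈ tensorSub ⊤ G) (h2 : z ∈ tensorSub F ⊤ ⊔ tensorSub ⊤ G') :
    z ∈ tensorSub F G ⊔ tensorSub ⊤ G' := by
  obtain ⟨e, he, heG⟩ := exists_proj G
  obtain ⟨u, hu, v, hv, rfl⟩ := Submodule.mem_sup.1 h2
  rw [← lTensor_eq_self he h1, map_add, lTensor_eq_self (fun b hb => he b (hG hb)) hv]
  refine Submodule.add_mem_sup ?_ hv
  exact map_mem_tensorSub (f := LinearMap.id) (fun a ha => ha) (fun b _ => heG b) hu

/-- Shift a filtration by one step: `F₋₁ = 0, F₀, F₁, …`. -/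
def shiftFil (F : ℕ → Submodule k V) : ℕ → Submodule k V
  | 0 => ⊥
  | n + 1 => F n

/-- The step `∑_{i + j = n} F_i ⊗ G_j` of the tensor product filtration. -/
def tensorFil (F : ℕ → Submodule k V) (G : ℕ → Submodule k W) (n : ℕ) : Submodule k (V ⊗[k] W) :=
  ⨆ p ∈ Finset.HasAntidiagonal.antidiagonal n, tensorSub (F p.1) (G p.2)

theorem tmul_mem_tensorFil {F : ℕ → Submodule k V} {G : ℕ → Submodule k W} {i j n : ℕ}
    (h : i + j = n) {a : V} {b : W} (ha : a ∈ F i) (hb : b ∈ G j) :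
    a ⊗ₜ[k] b ∈ tensorFil F G n :=
  (le_iSup₂_of_le (f := fun (p : ℕ × ℕ) (_ : p ∈ Finset.HasAntidiagonal.antidiagonal n) =>
    tensorSub (F p.1) (G p.2)) (i, j) (Finset.HasAntidiagonal.mem_antidiagonal.2 h) le_rfl)
    (tmul_mem_tensorSub ha hb)

theorem tensorFil_le {F : ℕ → Submodule k V} {G : ℕ → Submodule k W} {n : ℕ}
    {P : Submodule k (V ⊗[k] W)} :
    tensorFil F G n ≤ P ↔ ∀ i j, i + j = n → ∀ a ∈ F i, ∀ b ∈ G j, a ⊗ₜ[k] b ∈ P := by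
  simp only [tensorFil, iSup_le_iff, tensorSub_le, Finset.HasAntidiagonal.mem_antidiagonal, Prod.forall]

theorem shiftFil_le {F : ℕ → Submodule k V} (hF : Monotone F) (n : ℕ) : shiftFil F n ≤ F n := by
  cases n with
  | zero => exact bot_le
  | succ n => exact hF (Nat.le_succ n)

theorem mem_tensorFil_of_forall {F : ℕ → Submodule k V} {G : ℕ → Submodule k W}
    (hF : Monotone F) (hG : Monotone G) {n : ℕ} {z : V ⊗[k] W}
    (hz : ∀ i j, i + j = n + 1 → z ∈ tensorSub (shiftFil F i) ⊤ ⊔ tensorSub ⊤ (shiftFil G j)) :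
    z ∈ tensorFil F G n := by
  have key : ∀ m ≤ n + 1, ∃ s ∈ tensorFil F G n ⊓ tensorSub (shiftFil F m) ⊤,
      z - s ∈ tensorSub ⊤ (shiftFil G (n + 1 - m)) := by
    intro m
    induction m with
    | zero =>
      intro _
      refine ⟨0, Submodule.zero_mem _, ?_⟩
      have := hz 0 (n + 1) (by omega)
      have h0 : tensorSub (shiftFil F 0) (⊤ : Submodule k W) = ⊥ :=
        Submodule.map₂_bot_left _ _
      rw [h0, bot_sup_eq] at this
      simpa using this
    | succ m ih =>
      intro hm
      obtain ⟨s, hs, ht⟩ := ih (by omega)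
      obtain ⟨j, hj⟩ : ∃ j, n + 1 - m = j + 1 := ⟨n - m, by omega⟩
      have hj' : n + 1 - (m + 1) = j := by omega
      rw [hj] at ht
      rw [hj']
      have h2 : z - s ∈ tensorSub (F m) ⊤ ⊔ tensorSub ⊤ (shiftFil G j) :=
        Submodule.sub_mem _ (hz (m + 1) j (by omega))
          (Submodule.mem_sup_left (tensorSub_mono (shiftFil_le hF m) le_rfl hs.2))
      obtain ⟨u, hu, v, hv, huv⟩ :=
        Submodule.mem_sup.1 (mem_of_mem_of_mem (shiftFil_le hG j) ht h2)
      refine ⟨s + u, ⟨Submodule.add_mem _ hs.1 ?_, Submodule.add_mem _ ?_ ?_⟩, ?_⟩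
      · exact (tensorSub_le.2 fun a ha b hb =>
          tmul_mem_tensorFil (i := m) (j := j) (by omega) ha hb) hu
      · exact tensorSub_mono (shiftFil_le hF m) le_rfl hs.2
      · exact tensorSub_mono le_rfl le_top hu
      · have : z - (s + u) = v := by rw [← sub_sub, ← huv]; abel
        rwa [this]
  obtain ⟨s, hs, ht⟩ := key (n + 1) le_rfl
  have h0 : tensorSub (⊤ : Submodule k V) (shiftFil G (n + 1 - (n + 1))) = ⊥ := by
    rw [Nat.sub_self]; exact Submodule.map₂_bot_right _ _
  rw [h0, Submodule.mem_bot, sub_eq_zero] at ht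
  rw [ht]; exact hs.1

end LinearAlgebra

section Coalgebra

open Coalgebra

variable (k : Type*) [Field k]
variable (C : Type*) [AddCommGroup C] [Module k C] [Coalgebra k C]

variable {k C} in
/-- A subspace `D` of a coalgebra is a subcoalgebra if `Δ(D) ⊆ D ⊗ D`. -/
def IsSubcoalgebra (D : Submodule k C) : Prop :=
  ∀ d ∈ D, comul d ∈ tensorSub D D

variable {k C} in
/-- A simple subcoalgebra is a nonzero subcoalgebra whose only subcoalgebras are `0` and itself. -/
def IsSimpleSubcoalgebra (D : Submodule k C) : Prop :=
  IsSubcoalgebra D ∧ D ≠ ⊥ ∧ ∀ E : Submodule k C, E ≤ D → IsSubcoalgebra E → E = ⊥ ∨ E = D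

/-- The coradical: the sum of all simple subcoalgebras. -/
def coradical : Submodule k C :=
  sSup {D | IsSimpleSubcoalgebra D}

/-- The coradical filtration: `C_0` is the coradical and
`C_{n+1} = Δ⁻¹(C ⊗ C_n + C_0 ⊗ C)`. -/
def coradicalFiltration : ℕ → Submodule k C
  | 0 => coradical k C
  | n + 1 => (tensorSub ⊤ (coradicalFiltration n) ⊔ tensorSub (coradical k C) ⊤).comap comul

variable {k C}

theorem coradical_isSubcoalgebra : IsSubcoalgebra (coradical k C) := by
  intro d hd
  have : coradical k C ≤ (tensorSub (coradical k C) (coradical k C)).comap comul := by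
    refine sSup_le fun D hD x hx => ?_
    exact tensorSub_mono (le_sSup hD) (le_sSup hD) (hD.1 x hx)
  exact this hd

/-- The wedge `X ∧ Y = Δ⁻¹(X ⊗ C + C ⊗ Y)` of two subspaces of a coalgebra. -/
def wedge (X Y : Submodule k C) : Submodule k C :=
  (tensorSub X ⊤ ⊔ tensorSub ⊤ Y).comap comul

theorem mem_wedge {X Y : Submodule k C} {c : C} :
    c ∈ wedge X Y ↔ comul (R := k) c ∈ tensorSub X ⊤ ⊔ tensorSub ⊤ Y := Iff.rfl

theorem wedge_mono {X X' Y Y' : Submodule k C} (hX : X ≤ X') (hY : Y ≤ Y') :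
    wedge X Y ≤ wedge X' Y' :=
  Submodule.comap_mono (sup_le_sup (tensorSub_mono hX le_rfl) (tensorSub_mono le_rfl hY))

theorem ker_map_comp_comul {M N : Type*} [AddCommGroup M] [Module k M] [AddCommGroup N]
    [Module k N] (f : C →ₗ[k] M) (g : C →ₗ[k] N) :
    LinearMap.ker (TensorProduct.map f g ∘ₗ comul) = wedge (LinearMap.ker f) (LinearMap.ker g) := by
  rw [LinearMap.ker_comp, ker_map]; rfl

theorem wedge_eq_ker (X Y : Submodule k C) :
    wedge X Y = LinearMap.ker (TensorProduct.map X.mkQ Y.mkQ ∘ₗ comul) := by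
  rw [ker_map_comp_comul, Submodule.ker_mkQ, Submodule.ker_mkQ]

theorem wedge_assoc (X Y Z : Submodule k C) : wedge (wedge X Y) Z = wedge X (wedge Y Z) := by
  have h1 := ker_map_comp_comul (TensorProduct.map X.mkQ Y.mkQ ∘ₗ comul) Z.mkQ
  have h2 := ker_map_comp_comul X.mkQ (TensorProduct.map Y.mkQ Z.mkQ ∘ₗ comul)
  rw [← wedge_eq_ker, Submodule.ker_mkQ] at h1 h2
  rw [← h1, ← h2, ← LinearMap.ker_comp_of_ker_eq_bot (TensorProduct.map
    (TensorProduct.map X.mkQ Y.mkQ ∘ₗ comul) Z.mkQ ∘ₗ comul) (LinearEquiv.ker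
      (TensorProduct.assoc k (C ⧸ X) (C ⧸ Y) (C ⧸ Z)))]
  congr 1
  ext c
  simp only [LinearMap.comp_apply, LinearEquiv.coe_coe]
  have e1 : TensorProduct.map (TensorProduct.map X.mkQ Y.mkQ ∘ₗ comul) Z.mkQ (comul (R := k) c) =
      TensorProduct.map (TensorProduct.map X.mkQ Y.mkQ) Z.mkQ
        ((comul (R := k)).rTensor C (comul (R := k) c)) := by
    rw [LinearMap.rTensor, TensorProduct.map_map, LinearMap.comp_id]
  have e2 : TensorProduct.map X.mkQ (TensorProduct.map Y.mkQ Z.mkQ ∘ₗ comul) (comul (R := k) c) =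
      TensorProduct.map X.mkQ (TensorProduct.map Y.mkQ Z.mkQ)
        ((comul (R := k)).lTensor C (comul (R := k) c)) := by
    rw [LinearMap.lTensor, TensorProduct.map_map, LinearMap.comp_id]
  rw [e1, e2, ← Coalgebra.coassoc_apply]
  generalize (comul (R := k)).rTensor C (comul (R := k) c) = t
  have : (TensorProduct.assoc k (C ⧸ X) (C ⧸ Y) (C ⧸ Z)).toLinearMap ∘ₗ
      TensorProduct.map (TensorProduct.map X.mkQ Y.mkQ) Z.mkQ =
      TensorProduct.map X.mkQ (TensorProduct.map Y.mkQ Z.mkQ) ∘ₗ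
        (TensorProduct.assoc k C C C).toLinearMap := by
    ext a b c; simp
  exact LinearMap.congr_fun this t

theorem coradicalFiltration_succ (n : ℕ) : coradicalFiltration k C (n + 1) =
    wedge (coradicalFiltration k C 0) (coradicalFiltration k C n) := by
  rw [wedge, sup_comm]; rfl

theorem coradical_le_bot_wedge : coradical k C ≤ wedge ⊥ (coradical k C) := fun c hc =>
  Submodule.mem_sup_right (tensorSub_mono le_top le_rfl (coradical_isSubcoalgebra c hc))

theorem coradical_le_wedge_bot : coradical k C ≤ wedge (coradical k C) ⊥ := fun c hc =>
  Submodule.mem_sup_left (tensorSub_mono le_rfl le_top (coradical_isSubcoalgebra c hc))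

theorem coradicalFiltration_wedge (i j : ℕ) :
    wedge (coradicalFiltration k C i) (coradicalFiltration k C j) =
      coradicalFiltration k C (i + j + 1) := by
  induction i with
  | zero => rw [Nat.zero_add, coradicalFiltration_succ]
  | succ i ih =>
    rw [coradicalFiltration_succ, wedge_assoc, ih, ← coradicalFiltration_succ]
    congr 1; omega

theorem coradicalFiltration_le_bot_wedge (n : ℕ) :
    coradicalFiltration k C n ≤ wedge ⊥ (coradicalFiltration k C n) := by
  cases n with
  | zero => exact coradical_le_bot_wedge
  | succ n =>
    rw [coradicalFiltration_succ, ← wedge_assoc]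
    exact wedge_mono coradical_le_bot_wedge le_rfl

theorem coradicalFiltration_le_wedge_bot (n : ℕ) :
    coradicalFiltration k C n ≤ wedge (coradicalFiltration k C n) ⊥ := by
  cases n with
  | zero => exact coradical_le_wedge_bot
  | succ n =>
    have := coradicalFiltration_wedge (k := k) (C := C) n 0
    rw [Nat.add_zero] at this
    rw [← this, wedge_assoc]
    exact wedge_mono le_rfl coradical_le_wedge_bot

theorem coradicalFiltration_mono : Monotone (coradicalFiltration k C) := by
  refine monotone_nat_of_le_succ fun n => ?_
  rw [coradicalFiltration_succ]
  exact (coradicalFiltration_le_bot_wedge n).trans (wedge_mono bot_le le_rfl)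

theorem comul_mem_tensorFil {n : ℕ} {c : C} (hc : c ∈ coradicalFiltration k C n) :
    comul c ∈ tensorFil (coradicalFiltration k C) (coradicalFiltration k C) n := by
  refine mem_tensorFil_of_forall coradicalFiltration_mono coradicalFiltration_mono ?_
  rintro (_ | i) (_ | j) h
  · omega
  · obtain rfl : j = n := by omega
    exact coradicalFiltration_le_bot_wedge j hc
  · obtain rfl : i = n := by omega
    exact coradicalFiltration_le_wedge_bot i hc
  · obtain rfl : n = i + j + 1 := by omega
    rw [← coradicalFiltration_wedge] at hc
    exact hc

end Coalgebra

section Hopf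

open Coalgebra HopfAlgebra

variable (k : Type*) [Field k] (H : Type*) [Ring H] [HopfAlgebra k H]

/-- A Hopf algebra is pointed if its coradical is spanned by the group-like elements. -/
class IsPointed : Prop where
  coradical_eq_span : coradical k H = Submodule.span k {g : H | IsGroupLikeElem k g}

variable {k H}

theorem IsPointed.coradical_induction [IsPointed k H] {P : Submodule k H}
    (h : ∀ g : H, IsGroupLikeElem k g → g ∈ P) : coradicalFiltration k H 0 ≤ P := by
  change coradical k H ≤ P
  rw [IsPointed.coradical_eq_span, Submodule.span_le]
  exact h

theorem IsPointed.mem_coradical [IsPointed k H] {g : H} (hg : IsGroupLikeElem k g) :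
    g ∈ coradicalFiltration k H 0 := by
  change g ∈ coradical k H
  rw [IsPointed.coradical_eq_span]
  exact Submodule.subset_span hg

theorem one_mem_coradicalFiltration [IsPointed k H] (n : ℕ) : (1 : H) ∈ coradicalFiltration k H n :=
  coradicalFiltration_mono (Nat.zero_le n) (IsPointed.mem_coradical .one)

theorem mul_mem_coradicalFiltration [IsPointed k H] {n m : ℕ} {a b : H}
    (ha : a ∈ coradicalFiltration k H n) (hb : b ∈ coradicalFiltration k H m) :
    a * b ∈ coradicalFiltration k H (n + m) := by
  obtain ⟨N, hN⟩ : ∃ N, N = n + m := ⟨_, rfl⟩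
  induction N using Nat.strong_induction_on generalizing n m a b with
  | _ N ih =>
  subst hN
  have h0 : ∀ x ∈ coradicalFiltration k H 0, ∀ y ∈ coradicalFiltration k H 0,
      x * y ∈ coradicalFiltration k H 0 := by
    intro x hx y hy
    refine IsPointed.coradical_induction
      (P := (coradicalFiltration k H 0).comap (LinearMap.mulRight k y)) (fun g hg => ?_) hx
    exact IsPointed.coradical_induction
      (P := (coradicalFiltration k H 0).comap (LinearMap.mulLeft k g))
      (fun g' hg' => IsPointed.mem_coradical (hg.mul hg')) hy
  rcases hN : n + m with _ | N
  · obtain ⟨rfl, rfl⟩ : n = 0 ∧ m = 0 := by omega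
    exact h0 a ha b hb
  rw [hN] at ih
  rw [coradicalFiltration_succ, mem_wedge, Bialgebra.comul_mul]
  have hA := comul_mem_tensorFil ha
  have hB := comul_mem_tensorFil hb
  generalize (comul a : H ⊗[k] H) = x at hA
  generalize (comul b : H ⊗[k] H) = y at hB
  set P := tensorSub (coradicalFiltration k H 0) ⊤ ⊔
    tensorSub ⊤ (coradicalFiltration k H N) with hP
  refine (tensorFil_le (P := P.comap (LinearMap.mulRight k y))).2 ?_ hA
  intro i j hij u hu v hv
  refine (tensorFil_le (P := P.comap (LinearMap.mulLeft k (u ⊗ₜ[k] v)))).2 ?_ hB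
  intro i' j' hij' u' hu' v' hv'
  change (u ⊗ₜ[k] v) * (u' ⊗ₜ[k] v') ∈ P
  rw [Algebra.TensorProduct.tmul_mul_tmul]
  by_cases hi : i = 0 ∧ i' = 0
  · obtain ⟨rfl, rfl⟩ := hi
    exact Submodule.mem_sup_left (tmul_mem_tensorSub (h0 _ hu _ hu') trivial)
  · refine Submodule.mem_sup_right (tmul_mem_tensorSub trivial ?_)
    exact coradicalFiltration_mono (show j + j' ≤ N by omega) (ih (j + j') (by omega) hv hv' rfl)

theorem antipode_mul_comul_comul (b : H) :
    TensorProduct.map (LinearMap.mul' k H ∘ₗ (antipode k).rTensor H) LinearMap.id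
      ((TensorProduct.assoc k H H H).symm ((comul (R := k)).lTensor H (comul (R := k) b))) =
      1 ⊗ₜ[k] b := by
  rw [Coalgebra.coassoc_symm_apply, ← LinearMap.comp_apply, LinearMap.map_comp_rTensor, LinearMap.comp_assoc,
    HopfAlgebra.mul_antipode_rTensor_comul,
    show TensorProduct.map (Algebra.linearMap k H ∘ₗ counit) (LinearMap.id : H →ₗ[k] H) =
      (Algebra.linearMap k H).rTensor H ∘ₗ (counit (R := k)).rTensor H by
        rw [← LinearMap.rTensor_comp]; rfl,
    LinearMap.comp_apply, Coalgebra.rTensor_counit_comul]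
  simp

theorem comul_left_inv :
    WithConv.toConv (TensorProduct.map (antipode k (A := H)) (antipode k) ∘ₗ
      (TensorProduct.comm k H H).toLinearMap ∘ₗ comul) *
      WithConv.toConv (comul (R := k) (A := H)) = 1 := by
  apply WithConv.ofConv_injective
  ext a
  change LinearMap.mul' k (H ⊗[k] H) (TensorProduct.map (TensorProduct.map (antipode k (A := H))
    (antipode k) ∘ₗ (TensorProduct.comm k H H).toLinearMap ∘ₗ comul) comul (comul (R := k) a)) =
      algebraMap k (H ⊗[k] H) (counit (R := k) a)
  let M : H ⊗[k] H →ₗ[k] H ⊗[k] H :=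
    TensorProduct.map (LinearMap.mul' k H ∘ₗ (antipode k).rTensor H) LinearMap.id ∘ₗ
      (TensorProduct.assoc k H H H).symm.toLinearMap ∘ₗ (comul (R := k)).lTensor H
  let N : H ⊗[k] (H ⊗[k] H) →ₗ[k] H ⊗[k] H :=
    TensorProduct.lift (LinearMap.mul k (H ⊗[k] H) ∘ₗ TensorProduct.mk k H H 1 ∘ₗ antipode k)
  have hM : ∀ y w : H, M (y ⊗ₜ[k] w) = (antipode k y ⊗ₜ[k] 1) * comul (R := k) w := by
    intro y w
    simp only [M, LinearMap.comp_apply, LinearMap.lTensor_tmul, LinearEquiv.coe_coe]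
    generalize (comul (R := k) w) = t
    induction t using TensorProduct.induction_on with
    | zero => simp
    | tmul p q => simp
    | add p q hp hq => simp only [TensorProduct.tmul_add, map_add, hp, hq, mul_add]
  have key : LinearMap.mul' k (H ⊗[k] H) ∘ₗ TensorProduct.map (TensorProduct.map (antipode k (A := H))
      (antipode k) ∘ₗ (TensorProduct.comm k H H).toLinearMap ∘ₗ comul) (comul (R := k)) =
      N ∘ₗ M.lTensor H ∘ₗ (TensorProduct.assoc k H H H).toLinearMap ∘ₗ
        (comul (R := k)).rTensor H := by
    ext x w
    simp only [TensorProduct.AlgebraTensorModule.curry_apply, LinearMap.restrictScalars_self,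
      TensorProduct.curry_apply, LinearMap.comp_apply, TensorProduct.map_tmul,
      LinearMap.rTensor_tmul, LinearEquiv.coe_coe, LinearMap.mul'_apply]
    generalize (comul (R := k) x) = t
    induction t using TensorProduct.induction_on with
    | zero => simp
    | tmul p q =>
      simp only [TensorProduct.comm_tmul, TensorProduct.map_tmul, TensorProduct.assoc_tmul,
        LinearMap.lTensor_tmul, hM, N, TensorProduct.lift.tmul, LinearMap.comp_apply,
        TensorProduct.mk_apply, LinearMap.mul_apply']
      rw [← mul_assoc, Algebra.TensorProduct.tmul_mul_tmul, one_mul, mul_one]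
    | add p q hp hq => simp only [TensorProduct.add_tmul, map_add, hp, hq, add_mul]
  have h2 : M ∘ₗ comul (R := k) = TensorProduct.mk k H H 1 := by
    ext b; exact antipode_mul_comul_comul b
  have h3 := LinearMap.congr_fun key (comul (R := k) a)
  simp only [LinearMap.comp_apply, LinearEquiv.coe_coe] at h3
  rw [h3, Coalgebra.coassoc_apply, ← LinearMap.comp_apply (M.lTensor H), ← LinearMap.lTensor_comp,
    h2]
  have h4 : N ∘ₗ (TensorProduct.mk k H H 1).lTensor H =
      TensorProduct.mk k H H 1 ∘ₗ LinearMap.mul' k H ∘ₗ (antipode k).rTensor H := by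
    ext x w; simp [N]
  have h5 := LinearMap.congr_fun h4 (comul (R := k) a)
  simp only [LinearMap.comp_apply] at h5
  rw [h5, HopfAlgebra.mul_antipode_rTensor_comul_apply, Algebra.algebraMap_eq_smul_one,
    Algebra.algebraMap_eq_smul_one, Algebra.TensorProduct.one_def, TensorProduct.mk_apply,
    TensorProduct.tmul_smul]

theorem comul_antipode (a : H) : comul (R := k) (antipode k a) =
    TensorProduct.map (antipode k) (antipode k) (TensorProduct.comm k H H (comul a)) := by
  have := left_inv_eq_right_inv comul_left_inv (LinearMap.comul_right_inv (R := k) (C := H))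
  exact (LinearMap.congr_fun (WithConv.toConv_injective this) a).symm

theorem antipode_mem_coradicalFiltration [IsPointed k H] {n : ℕ} {a : H}
    (ha : a ∈ coradicalFiltration k H n) : antipode k a ∈ coradicalFiltration k H n := by
  induction n using Nat.strong_induction_on generalizing a with
  | _ n ih =>
  rcases n with _ | n
  · exact IsPointed.coradical_induction
      (P := (coradicalFiltration k H 0).comap (antipode k))
      (fun g hg => IsPointed.mem_coradical (IsGroupLikeElem.antipode hg)) ha
  rw [coradicalFiltration_succ, mem_wedge, comul_antipode]
  set P := tensorSub (coradicalFiltration k H 0) ⊤ ⊔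
    tensorSub ⊤ (coradicalFiltration k H n) with hP
  refine (tensorFil_le (P := P.comap (TensorProduct.map (antipode k) (antipode k) ∘ₗ
    (TensorProduct.comm k H H).toLinearMap))).2 ?_ (comul_mem_tensorFil ha)
  intro i j hij u hu v hv
  simp only [Submodule.mem_comap, LinearMap.comp_apply, LinearEquiv.coe_coe,
    TensorProduct.comm_tmul, TensorProduct.map_tmul]
  rcases j with _ | j
  · exact Submodule.mem_sup_left (tmul_mem_tensorSub (ih 0 (by omega) hv) trivial)
  · refine Submodule.mem_sup_right (tmul_mem_tensorSub trivial ?_)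
    exact coradicalFiltration_mono (show i ≤ n by omega) (ih i (by omega) hu)

end Hopf

section AssociatedGraded

open Coalgebra HopfAlgebra DirectSum

variable (k : Type*) [Field k] (H : Type*) [Ring H] [HopfAlgebra k H]

/-- The homogeneous component `gr H (n) = H_n / H_{n-1}` (with `H_{-1} = 0`) of the associated
graded space of `H` with respect to the coradical filtration. -/
def GrPiece (n : ℕ) : Type _ :=
  ↥(coradicalFiltration k H n) ⧸
    (shiftFil (coradicalFiltration k H) n).submoduleOf (coradicalFiltration k H n)

instance (n : ℕ) : AddCommGroup (GrPiece k H n) :=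
  inferInstanceAs (AddCommGroup (_ ⧸ Submodule.submoduleOf _ _))

instance (n : ℕ) : Module k (GrPiece k H n) :=
  inferInstanceAs (Module k (_ ⧸ Submodule.submoduleOf _ _))

/-- The associated graded space `gr H = ⨁ n, H_n / H_{n-1}`. -/
abbrev Gr : Type _ := ⨁ n, GrPiece k H n

variable {k H}

/-- The class in `H_n / H_{n-1}` of an element of `H_n`. -/
def symb (n : ℕ) : ↥(coradicalFiltration k H n) →ₗ[k] GrPiece k H n :=
  Submodule.mkQ _

theorem symb_surjective (n : ℕ) : Function.Surjective (symb (k := k) (H := H) n) :=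
  Submodule.mkQ_surjective _

theorem symb_eq_zero {n : ℕ} {a : H} (ha : a ∈ coradicalFiltration k H n)
    (ha' : a ∈ shiftFil (coradicalFiltration k H) n) : symb n ⟨a, ha⟩ = 0 :=
  (Submodule.Quotient.mk_eq_zero _).2 ha'

/-- A linear map on `H_n` that vanishes on `H_{n-1}` descends to `H_n / H_{n-1}`. -/
def pieceLift {M : Type*} [AddCommGroup M] [Module k M] (n : ℕ)
    (f : ↥(coradicalFiltration k H n) →ₗ[k] M)
    (hf : ∀ a : ↥(coradicalFiltration k H n),
      (a : H) ∈ shiftFil (coradicalFiltration k H) n → f a = 0) : GrPiece k H n →ₗ[k] M :=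
  Submodule.liftQ _ f fun a ha => hf a ha

theorem pieceLift_symb {M : Type*} [AddCommGroup M] [Module k M] (n : ℕ)
    (f : ↥(coradicalFiltration k H n) →ₗ[k] M)
    (hf : ∀ a : ↥(coradicalFiltration k H n),
      (a : H) ∈ shiftFil (coradicalFiltration k H) n → f a = 0) (a) :
    pieceLift n f hf (symb n a) = f a :=
  Submodule.liftQ_apply _ _ _

theorem mul_mem_shiftFil_left [IsPointed k H] {n m : ℕ} {a b : H}
    (ha : a ∈ shiftFil (coradicalFiltration k H) n) (hb : b ∈ coradicalFiltration k H m) :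
    a * b ∈ shiftFil (coradicalFiltration k H) (n + m) := by
  cases n with
  | zero =>
    obtain rfl : a = 0 := ha
    rw [zero_mul]; exact Submodule.zero_mem _
  | succ n =>
    rw [show n + 1 + m = n + m + 1 by omega]
    exact mul_mem_coradicalFiltration ha hb

theorem mul_mem_shiftFil_right [IsPointed k H] {n m : ℕ} {a b : H}
    (ha : a ∈ coradicalFiltration k H n) (hb : b ∈ shiftFil (coradicalFiltration k H) m) :
    a * b ∈ shiftFil (coradicalFiltration k H) (n + m) := by
  cases m with
  | zero =>
    obtain rfl : b = 0 := hb
    rw [mul_zero]; exact Submodule.zero_mem _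
  | succ m => exact mul_mem_coradicalFiltration ha hb

/-- The multiplication `H_n × H_m → H_{n+m} / H_{n+m-1}`, `(a, b) ↦ [ab]`. -/
def symbMul [IsPointed k H] (n m : ℕ) :
    ↥(coradicalFiltration k H n) →ₗ[k] ↥(coradicalFiltration k H m) →ₗ[k] GrPiece k H (n + m) :=
  LinearMap.mk₂ k
    (fun a b => symb (n + m) ⟨(a : H) * (b : H), mul_mem_coradicalFiltration a.2 b.2⟩)
    (fun a a' b => by
      rw [← map_add]; exact congrArg _ (Subtype.ext (add_mul (a : H) (a' : H) (b : H))))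
    (fun c a b => by
      rw [← map_smul]; exact congrArg _ (Subtype.ext (smul_mul_assoc c (a : H) (b : H))))
    (fun a b b' => by
      rw [← map_add]; exact congrArg _ (Subtype.ext (mul_add (a : H) (b : H) (b' : H))))
    (fun c a b => by
      rw [← map_smul]; exact congrArg _ (Subtype.ext (mul_smul_comm c (a : H) (b : H))))

/-- The multiplication `H_n × H_m / H_{m-1} → H_{n+m} / H_{n+m-1}`, `(a, [b]) ↦ [ab]`. -/
def symbPieceMul [IsPointed k H] (n m : ℕ) :
    ↥(coradicalFiltration k H n) →ₗ[k] GrPiece k H m →ₗ[k] GrPiece k H (n + m) :=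
  (pieceLift m (symbMul n m).flip fun _ hb =>
    LinearMap.ext fun a => symb_eq_zero _ (mul_mem_shiftFil_right a.2 hb)).flip

theorem symbPieceMul_symb [IsPointed k H] {n m : ℕ} (a : ↥(coradicalFiltration k H n))
    (b : ↥(coradicalFiltration k H m)) : symbPieceMul n m a (symb m b) =
      symb (n + m) ⟨(a : H) * (b : H), mul_mem_coradicalFiltration a.2 b.2⟩ := by
  rw [symbPieceMul, LinearMap.flip_apply, pieceLift_symb]; rfl

/-- The multiplication `H_n / H_{n-1} × H_m / H_{m-1} → H_{n+m} / H_{n+m-1}` induced by that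
of `H`: `([a], [b]) ↦ [ab]`. -/
def pieceMul [IsPointed k H] (n m : ℕ) :
    GrPiece k H n →ₗ[k] GrPiece k H m →ₗ[k] GrPiece k H (n + m) :=
  pieceLift n (symbPieceMul n m) fun a ha => LinearMap.ext fun y => by
    obtain ⟨b, rfl⟩ := symb_surjective m y
    rw [symbPieceMul_symb]
    exact symb_eq_zero _ (mul_mem_shiftFil_left ha b.2)

theorem pieceMul_symb [IsPointed k H] {n m : ℕ} (a : ↥(coradicalFiltration k H n))
    (b : ↥(coradicalFiltration k H m)) : pieceMul n m (symb n a) (symb m b) =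
      symb (n + m) ⟨(a : H) * (b : H), mul_mem_coradicalFiltration a.2 b.2⟩ := by
  rw [pieceMul, pieceLift_symb, symbPieceMul_symb]

theorem gradedMk_eq {n m : ℕ} (h : n = m) {a b : H} (ha : a ∈ coradicalFiltration k H n)
    (hb : b ∈ coradicalFiltration k H m) (hab : a = b) :
    GradedMonoid.mk (A := GrPiece k H) n (symb n ⟨a, ha⟩) = GradedMonoid.mk m (symb m ⟨b, hb⟩) := by
  subst h; subst hab; rfl

variable (k H) in
/-- The unit of `gr H`: the class of `1` in `H_0`. -/
def pieceOne [IsPointed k H] : GrPiece k H 0 := symb 0 ⟨1, one_mem_coradicalFiltration 0⟩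

instance [IsPointed k H] : GradedMonoid.GOne (GrPiece k H) where
  one := pieceOne k H

instance [IsPointed k H] : GradedMonoid.GMul (GrPiece k H) where
  mul {n m} x y := pieceMul n m x y

instance [IsPointed k H] : DirectSum.GRing (GrPiece k H) where
  mul_zero _ := map_zero _
  zero_mul _ := LinearMap.map_zero₂ _ _
  mul_add _ _ _ := map_add _ _ _
  add_mul _ _ _ := LinearMap.map_add₂ _ _ _ _
  one_mul := by
    rintro ⟨n, x⟩
    obtain ⟨a, rfl⟩ := symb_surjective n x
    exact (congrArg _ (pieceMul_symb _ _)).trans (gradedMk_eq (by simp) _ _ (one_mul _))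
  mul_one := by
    rintro ⟨n, x⟩
    obtain ⟨a, rfl⟩ := symb_surjective n x
    exact (congrArg _ (pieceMul_symb _ _)).trans (gradedMk_eq (by simp) _ _ (mul_one _))
  mul_assoc := by
    rintro ⟨n, x⟩ ⟨m, y⟩ ⟨l, z⟩
    obtain ⟨a, rfl⟩ := symb_surjective n x
    obtain ⟨b, rfl⟩ := symb_surjective m y
    obtain ⟨c, rfl⟩ := symb_surjective l z
    change GradedMonoid.mk (n + m + l) (pieceMul _ _ (pieceMul _ _ _ _) _) =
      GradedMonoid.mk (n + (m + l)) (pieceMul _ _ _ (pieceMul _ _ _ _))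
    rw [pieceMul_symb, pieceMul_symb, pieceMul_symb, pieceMul_symb]
    exact gradedMk_eq (add_assoc _ _ _) _ _ (mul_assoc _ _ _)
  natCast n := n • pieceOne k H
  natCast_zero := zero_nsmul _
  natCast_succ n := succ_nsmul _ n
  intCast n := n • pieceOne k H
  intCast_ofNat n := natCast_zsmul _ n
  intCast_negSucc_ofNat n := negSucc_zsmul _ n

instance [IsPointed k H] : DirectSum.GAlgebra k (GrPiece k H) where
  toFun := (LinearMap.toSpanSingleton k _ (pieceOne k H)).toAddMonoidHom
  map_one := one_smul k (pieceOne k H)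
  map_mul r s := by
    change _ = GradedMonoid.mk (0 + 0) (pieceMul 0 0 (r • pieceOne k H) (s • pieceOne k H))
    change GradedMonoid.mk 0 ((r * s) • pieceOne k H) = _
    simp only [pieceOne, ← map_smul]
    rw [pieceMul_symb]
    exact gradedMk_eq rfl _ _ (by simp [← mul_smul, mul_comm])
  commutes r := by
    rintro ⟨n, x⟩
    obtain ⟨a, rfl⟩ := symb_surjective n x
    change GradedMonoid.mk (0 + n) (pieceMul 0 n (r • pieceOne k H) _) =
      GradedMonoid.mk (n + 0) (pieceMul n 0 _ (r • pieceOne k H))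
    simp only [pieceOne, ← map_smul]
    rw [pieceMul_symb, pieceMul_symb]
    exact gradedMk_eq (by omega) _ _ (by simp)
  smul_def r := by
    rintro ⟨n, x⟩
    obtain ⟨a, rfl⟩ := symb_surjective n x
    change GradedMonoid.mk n (r • symb n a) =
      GradedMonoid.mk (0 + n) (pieceMul 0 n (r • pieceOne k H) _)
    simp only [pieceOne, ← map_smul]
    rw [pieceMul_symb]
    exact gradedMk_eq (by omega) _ _ (by simp)

theorem exists_pieceProj (n : ℕ) : ∃ p : H →ₗ[k] GrPiece k H n,
    ∀ a : ↥(coradicalFiltration k H n), p a = symb n a := by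
  obtain ⟨p, hp⟩ := LinearMap.exists_extend (symb (k := k) (H := H) n)
  exact ⟨p, fun a => LinearMap.congr_fun hp a⟩

/-- A linear map `H → gr H` that sends every `a ∈ H_n` to its class in `H_n / H_{n-1}`; outside
`H_n` its values are arbitrary and irrelevant. -/
def grClass (n : ℕ) : H →ₗ[k] Gr k H :=
  DirectSum.lof k ℕ (GrPiece k H) n ∘ₗ (exists_pieceProj n).choose

theorem grClass_eq {n : ℕ} {a : H} (ha : a ∈ coradicalFiltration k H n) :
    grClass n a = DirectSum.lof k ℕ (GrPiece k H) n (symb n ⟨a, ha⟩) :=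
  congrArg (DirectSum.lof k ℕ (GrPiece k H) n) ((exists_pieceProj n).choose_spec ⟨a, ha⟩)

theorem grClass_eq_zero {n : ℕ} {a : H} (ha : a ∈ shiftFil (coradicalFiltration k H) n) :
    grClass (k := k) n a = 0 := by
  rw [grClass_eq (shiftFil_le coradicalFiltration_mono n ha), symb_eq_zero _ ha, map_zero]

theorem grClass_eq_zero_of_lt {n m : ℕ} {a : H} (ha : a ∈ coradicalFiltration k H m) (h : m < n) :
    grClass (k := k) n a = 0 := by
  obtain ⟨n, rfl⟩ : ∃ n', n = n' + 1 := ⟨n - 1, by omega⟩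
  exact grClass_eq_zero (coradicalFiltration_mono (show m ≤ n by omega) ha)

theorem grClass_mul [IsPointed k H] {n m : ℕ} {a b : H} (ha : a ∈ coradicalFiltration k H n)
    (hb : b ∈ coradicalFiltration k H m) :
    grClass (k := k) n a * grClass m b = grClass (n + m) (a * b) := by
  rw [grClass_eq ha, grClass_eq hb, grClass_eq (mul_mem_coradicalFiltration ha hb)]
  refine (DirectSum.of_mul_of _ _).trans ?_
  exact congrArg (DirectSum.of (GrPiece k H) (n + m)) (pieceMul_symb ⟨a, ha⟩ ⟨b, hb⟩)

theorem grClass_one [IsPointed k H] : grClass (k := k) 0 (1 : H) = 1 :=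
  grClass_eq (one_mem_coradicalFiltration 0)

theorem gr_induction {P : Submodule k (Gr k H)}
    (h : ∀ n, ∀ a ∈ coradicalFiltration k H n, grClass n a ∈ P) (x : Gr k H) : x ∈ P := by
  induction x using DirectSum.induction_on with
  | zero => exact P.zero_mem
  | of n x =>
    obtain ⟨a, rfl⟩ := symb_surjective n x
    have := h n a a.2
    rwa [grClass_eq a.2] at this
  | add x y hx hy => exact P.add_mem hx hy

theorem gr_hom_ext {M : Type*} [AddCommGroup M] [Module k M] {f g : Gr k H →ₗ[k] M}
    (h : ∀ n, ∀ a ∈ coradicalFiltration k H n, f (grClass n a) = g (grClass n a)) : f = g := by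
  ext1 n
  ext x
  obtain ⟨a, rfl⟩ := symb_surjective n x
  have := h n a a.2
  rwa [grClass_eq a.2] at this

/-- Linear maps `f n` on `H` that vanish on `H_{n-1}` induce a linear map on `gr H`, which sends the
class of `a ∈ H_n` in `H_n / H_{n-1}` to `f n a`. -/
def grLift {M : Type*} [AddCommGroup M] [Module k M] (f : ℕ → H →ₗ[k] M)
    (hf : ∀ n, ∀ a ∈ shiftFil (coradicalFiltration k H) n, f n a = 0) : Gr k H →ₗ[k] M :=
  DirectSum.toModule k ℕ M fun n =>
    pieceLift n ((f n).domRestrict (coradicalFiltration k H n)) fun a ha => hf n a ha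

theorem grLift_grClass {M : Type*} [AddCommGroup M] [Module k M] (f : ℕ → H →ₗ[k] M)
    (hf : ∀ n, ∀ a ∈ shiftFil (coradicalFiltration k H) n, f n a = 0) {n : ℕ} {a : H}
    (ha : a ∈ coradicalFiltration k H n) : grLift f hf (grClass n a) = f n a := by
  rw [grClass_eq ha, grLift, DirectSum.toModule_lof]
  exact pieceLift_symb _ _ _ _

theorem tensorFil_ext {V W M : Type*} [AddCommGroup V] [Module k V] [AddCommGroup W] [Module k W]
    [AddCommGroup M] [Module k M] {F : ℕ → Submodule k V} {G : ℕ → Submodule k W} {n : ℕ}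
    {f g : V ⊗[k] W →ₗ[k] M}
    (h : ∀ i j, i + j = n → ∀ a ∈ F i, ∀ b ∈ G j, f (a ⊗ₜ[k] b) = g (a ⊗ₜ[k] b))
    {z : V ⊗[k] W} (hz : z ∈ tensorFil F G n) : f z = g z :=
  (tensorFil_le (P := LinearMap.eqLocus f g)).2 h hz

theorem sum_map_tmul {V W M N : Type*} [AddCommGroup V] [Module k V] [AddCommGroup W] [Module k W]
    [AddCommGroup M] [Module k M] [AddCommGroup N] [Module k N] (f : ℕ → V →ₗ[k] M)
    (g : ℕ → W →ₗ[k] N) {i j n : ℕ} (h : i + j = n) {u : V} {v : W}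
    (hu : ∀ m, i < m → f m u = 0) (hv : ∀ m, j < m → g m v = 0) :
    (∑ p ∈ Finset.HasAntidiagonal.antidiagonal n, TensorProduct.map (f p.1) (g p.2)) (u ⊗ₜ[k] v) =
      f i u ⊗ₜ[k] g j v := by
  rw [LinearMap.sum_apply, Finset.sum_eq_single (i, j)]
  · rfl
  · rintro ⟨p, q⟩ hpq hne
    rw [Finset.HasAntidiagonal.mem_antidiagonal] at hpq
    rw [TensorProduct.map_tmul]
    rcases lt_trichotomy i p with hip | hip | hip
    · rw [hu p hip, TensorProduct.zero_tmul]
    · exact absurd (Prod.ext hip.symm (by simp only at hpq ⊢; omega)) hne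
    · rw [hv q (by simp only at hpq; omega), TensorProduct.tmul_zero]
  · intro hn
    exact absurd (Finset.HasAntidiagonal.mem_antidiagonal.2 h) hn

variable (k H) in
/-- On `∑_{i+j=n} H_i ⊗ H_j` this is the class map to `⨁_{i+j=n} gr H (i) ⊗ gr H (j)`:
it sends `u ⊗ v` with `u ∈ H_i`, `v ∈ H_j` and `i + j = n` to `[u] ⊗ [v]` (see `grTensor_tmul`). -/
def grTensor (n : ℕ) : H ⊗[k] H →ₗ[k] Gr k H ⊗[k] Gr k H :=
  ∑ p ∈ Finset.HasAntidiagonal.antidiagonal n, TensorProduct.map (grClass p.1) (grClass p.2)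

theorem grTensor_tmul {i j n : ℕ} (h : i + j = n) {u v : H} (hu : u ∈ coradicalFiltration k H i)
    (hv : v ∈ coradicalFiltration k H j) :
    grTensor k H n (u ⊗ₜ[k] v) = grClass i u ⊗ₜ[k] grClass j v :=
  sum_map_tmul _ _ h (fun _ hm => grClass_eq_zero_of_lt hu hm)
    (fun _ hm => grClass_eq_zero_of_lt hv hm)

theorem grTensor_eq_zero {m n : ℕ} (h : m < n) {z : H ⊗[k] H}
    (hz : z ∈ tensorFil (coradicalFiltration k H) (coradicalFiltration k H) m) :
    grTensor k H n z = 0 := by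
  refine tensorFil_ext (g := 0) (fun i j hij u hu v hv => ?_) hz
  rw [grTensor_tmul (i := i) (j := n - i) (by omega) hu
    (coradicalFiltration_mono (by omega) hv), grClass_eq_zero_of_lt hv (by omega),
    TensorProduct.tmul_zero, LinearMap.zero_apply]

theorem grTensor_comul_eq_zero (n : ℕ) (a : H) (ha : a ∈ shiftFil (coradicalFiltration k H) n) :
    (grTensor k H n ∘ₗ comul) a = 0 := by
  cases n with
  | zero =>
    obtain rfl : a = 0 := ha
    exact map_zero _
  | succ n => exact grTensor_eq_zero (Nat.lt_succ_self n) (comul_mem_tensorFil ha)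

/-- The comultiplication of `gr H`: if `a ∈ H_n` and `Δ(a) = ∑ u ⊗ v` with `u ∈ H_i`, `v ∈ H_j`,
`i + j = n`, then `Δ([a]) = ∑ [u] ⊗ [v]`. The counit of `gr H`: it is the counit of `H` on
`gr H (0) = H_0` and zero on `gr H (n)` for `n > 0`. -/
instance : CoalgebraStruct k (Gr k H) where
  comul := grLift (fun n => grTensor k H n ∘ₗ comul) grTensor_comul_eq_zero
  counit := grLift (fun n => if n = 0 then counit else 0) fun n a ha => by
    cases n with
    | zero =>
      obtain rfl : a = 0 := ha
      exact map_zero _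
    | succ n => rfl

theorem comul_grClass {n : ℕ} {a : H} (ha : a ∈ coradicalFiltration k H n) :
    comul (R := k) (grClass (k := k) n a) = grTensor k H n (comul a) :=
  grLift_grClass _ _ ha

theorem counit_grClass {n : ℕ} {a : H} (ha : a ∈ coradicalFiltration k H n) :
    counit (R := k) (grClass (k := k) n a) = if n = 0 then counit (R := k) a else 0 := by
  refine (grLift_grClass _ _ ha).trans ?_
  split <;> rfl

variable (k H) in
/-- The analogue of `grTensor` on triple tensors. -/
def grTensor₃ (n : ℕ) : H ⊗[k] (H ⊗[k] H) →ₗ[k] Gr k H ⊗[k] (Gr k H ⊗[k] Gr k H) :=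
  ∑ p ∈ Finset.HasAntidiagonal.antidiagonal n, TensorProduct.map (grClass p.1) (grTensor k H p.2)

theorem grTensor₃_tmul {i j n : ℕ} (h : i + j = n) {u : H} (hu : u ∈ coradicalFiltration k H i)
    {t : H ⊗[k] H} (ht : t ∈ tensorFil (coradicalFiltration k H) (coradicalFiltration k H) j) :
    grTensor₃ k H n (u ⊗ₜ[k] t) = grClass i u ⊗ₜ[k] grTensor k H j t :=
  sum_map_tmul _ _ h (fun _ hm => grClass_eq_zero_of_lt hu hm)
    (fun _ hm => grTensor_eq_zero hm ht)

instance : Coalgebra k (Gr k H) where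
  coassoc := by
    refine gr_hom_ext fun n a ha => ?_
    simp only [LinearMap.comp_apply, LinearEquiv.coe_coe]
    rw [comul_grClass ha]
    have hL : ((TensorProduct.assoc k (Gr k H) (Gr k H) (Gr k H)).toLinearMap ∘ₗ
        comul.rTensor (Gr k H) ∘ₗ grTensor k H n) (comul a) =
        (grTensor₃ k H n ∘ₗ (TensorProduct.assoc k H H H).toLinearMap ∘ₗ comul.rTensor H)
          (comul a) := by
      refine tensorFil_ext (fun i j hij u hu v hv => ?_) (comul_mem_tensorFil ha)
      simp only [LinearMap.comp_apply, LinearEquiv.coe_coe, grTensor_tmul hij hu hv,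
        LinearMap.rTensor_tmul, comul_grClass hu]
      refine tensorFil_ext (f := (TensorProduct.assoc k (Gr k H) (Gr k H) (Gr k H)).toLinearMap ∘ₗ
        (TensorProduct.mk k _ _).flip (grClass j v) ∘ₗ grTensor k H i)
        (g := grTensor₃ k H n ∘ₗ (TensorProduct.assoc k H H H).toLinearMap ∘ₗ
          (TensorProduct.mk k _ _).flip v) (fun p q hpq x hx y hy => ?_) (comul_mem_tensorFil hu)
      simp only [LinearMap.comp_apply, LinearEquiv.coe_coe, LinearMap.flip_apply,
        TensorProduct.mk_apply, grTensor_tmul hpq hx hy, TensorProduct.assoc_tmul]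
      rw [grTensor₃_tmul (i := p) (j := q + j) (by omega) hx (tmul_mem_tensorFil rfl hy hv),
        grTensor_tmul rfl hy hv]
    have hR : (comul.lTensor (Gr k H) ∘ₗ grTensor k H n) (comul a) =
        (grTensor₃ k H n ∘ₗ comul.lTensor H) (comul a) := by
      refine tensorFil_ext (fun i j hij u hu v hv => ?_) (comul_mem_tensorFil ha)
      simp only [LinearMap.comp_apply, grTensor_tmul hij hu hv, LinearMap.lTensor_tmul,
        comul_grClass hv]
      rw [grTensor₃_tmul hij hu (comul_mem_tensorFil hv)]
    simp only [LinearMap.comp_apply, LinearEquiv.coe_coe] at hL hR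
    rw [hL, hR, Coalgebra.coassoc_apply]
  rTensor_counit_comp_comul := by
    refine gr_hom_ext fun n a ha => ?_
    simp only [LinearMap.comp_apply]
    rw [comul_grClass ha]
    have h : (counit.rTensor (Gr k H) ∘ₗ grTensor k H n) (comul a) =
        ((grClass n).lTensor k ∘ₗ counit.rTensor H) (comul a) := by
      refine tensorFil_ext (fun i j hij u hu v hv => ?_) (comul_mem_tensorFil ha)
      simp only [LinearMap.comp_apply, grTensor_tmul hij hu hv, LinearMap.rTensor_tmul,
        LinearMap.lTensor_tmul, counit_grClass hu]
      split_ifs with hi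
      · obtain rfl : j = n := by omega
        rfl
      · rw [grClass_eq_zero_of_lt (n := n) hv (by omega), TensorProduct.zero_tmul,
          TensorProduct.tmul_zero]
    simp only [LinearMap.comp_apply] at h
    rw [h, Coalgebra.rTensor_counit_comul]; rfl
  lTensor_counit_comp_comul := by
    refine gr_hom_ext fun n a ha => ?_
    simp only [LinearMap.comp_apply]
    rw [comul_grClass ha]
    have h : (counit.lTensor (Gr k H) ∘ₗ grTensor k H n) (comul a) =
        ((grClass n).rTensor k ∘ₗ counit.lTensor H) (comul a) := by
      refine tensorFil_ext (fun i j hij u hu v hv => ?_) (comul_mem_tensorFil ha)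
      simp only [LinearMap.comp_apply, grTensor_tmul hij hu hv, LinearMap.rTensor_tmul,
        LinearMap.lTensor_tmul, counit_grClass hv]
      split_ifs with hi
      · obtain rfl : i = n := by omega
        rfl
      · rw [grClass_eq_zero_of_lt (n := n) hu (by omega), TensorProduct.zero_tmul,
          TensorProduct.tmul_zero]
    simp only [LinearMap.comp_apply] at h
    rw [h, Coalgebra.lTensor_counit_comul]; rfl

theorem gr_counit_mul [IsPointed k H] (x y : Gr k H) :
    counit (R := k) (x * y) = counit (R := k) x * counit (R := k) y := by
  refine gr_induction (P := LinearMap.eqLocus (counit (R := k) ∘ₗ LinearMap.mulRight k y)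
    (LinearMap.mulRight k (counit (R := k) y) ∘ₗ counit)) (fun n a ha => ?_) x
  refine gr_induction (P := LinearMap.eqLocus (counit (R := k) ∘ₗ LinearMap.mulLeft k (grClass n a))
    (LinearMap.mulLeft k (counit (R := k) (grClass (k := k) n a)) ∘ₗ counit)) (fun m b hb => ?_) y
  change counit (R := k) (grClass (k := k) n a * grClass m b) =
    counit (R := k) (grClass (k := k) n a) * counit (R := k) (grClass (k := k) m b)
  rw [grClass_mul ha hb, counit_grClass (mul_mem_coradicalFiltration ha hb), counit_grClass ha,
    counit_grClass hb, Bialgebra.counit_mul]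
  rcases n with _ | n <;> rcases m with _ | m <;> simp

theorem grTensor_mul [IsPointed k H] {n m : ℕ} {x y : H ⊗[k] H}
    (hx : x ∈ tensorFil (coradicalFiltration k H) (coradicalFiltration k H) n)
    (hy : y ∈ tensorFil (coradicalFiltration k H) (coradicalFiltration k H) m) :
    grTensor k H (n + m) (x * y) = grTensor k H n x * grTensor k H m y := by
  refine tensorFil_ext (f := grTensor k H (n + m) ∘ₗ LinearMap.mulRight k y)
    (g := LinearMap.mulRight k (grTensor k H m y) ∘ₗ grTensor k H n)
    (fun i j hij u hu v hv => ?_) hx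
  refine tensorFil_ext (f := grTensor k H (n + m) ∘ₗ LinearMap.mulLeft k (u ⊗ₜ[k] v))
    (g := LinearMap.mulLeft k (grTensor k H n (u ⊗ₜ[k] v)) ∘ₗ grTensor k H m)
    (fun i' j' hij' u' hu' v' hv' => ?_) hy
  change grTensor k H (n + m) ((u ⊗ₜ[k] v) * (u' ⊗ₜ[k] v')) =
    grTensor k H n (u ⊗ₜ[k] v) * grTensor k H m (u' ⊗ₜ[k] v')
  rw [Algebra.TensorProduct.tmul_mul_tmul, grTensor_tmul hij hu hv, grTensor_tmul hij' hu' hv',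
    Algebra.TensorProduct.tmul_mul_tmul, grClass_mul hu hu', grClass_mul hv hv',
    grTensor_tmul (by omega) (mul_mem_coradicalFiltration hu hu')
      (mul_mem_coradicalFiltration hv hv')]

theorem gr_comul_mul [IsPointed k H] (x y : Gr k H) :
    comul (R := k) (x * y) = comul (R := k) x * comul (R := k) y := by
  refine gr_induction (P := LinearMap.eqLocus (comul (R := k) ∘ₗ LinearMap.mulRight k y)
    (LinearMap.mulRight k (comul (R := k) y) ∘ₗ comul)) (fun n a ha => ?_) x
  refine gr_induction (P := LinearMap.eqLocus (comul (R := k) ∘ₗ LinearMap.mulLeft k (grClass n a))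
    (LinearMap.mulLeft k (comul (R := k) (grClass (k := k) n a)) ∘ₗ comul)) (fun m b hb => ?_) y
  change comul (R := k) (grClass (k := k) n a * grClass m b) =
    comul (R := k) (grClass (k := k) n a) * comul (R := k) (grClass (k := k) m b)
  rw [grClass_mul ha hb, comul_grClass (mul_mem_coradicalFiltration ha hb), comul_grClass ha,
    comul_grClass hb, Bialgebra.comul_mul,
    grTensor_mul (comul_mem_tensorFil ha) (comul_mem_tensorFil hb)]

instance [IsPointed k H] : Bialgebra k (Gr k H) :=
  Bialgebra.mk' k (Gr k H)
    (by
      rw [← grClass_one, counit_grClass (one_mem_coradicalFiltration 0), if_pos rfl,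
        Bialgebra.counit_one])
    (gr_counit_mul _ _)
    (by
      rw [← grClass_one, comul_grClass (one_mem_coradicalFiltration 0), Bialgebra.comul_one,
        Algebra.TensorProduct.one_def, grTensor_tmul rfl (one_mem_coradicalFiltration 0)
          (one_mem_coradicalFiltration 0), grClass_one, Algebra.TensorProduct.one_def])
    (gr_comul_mul _ _)

theorem grClass_antipode_eq_zero [IsPointed k H] (n : ℕ) (a : H)
    (ha : a ∈ shiftFil (coradicalFiltration k H) n) : (grClass n ∘ₗ antipode k (A := H)) a = 0 := by
  cases n with
  | zero =>
    obtain rfl : a = 0 := ha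
    exact map_zero _
  | succ n =>
    exact grClass_eq_zero_of_lt (antipode_mem_coradicalFiltration ha) (Nat.lt_succ_self n)

/-- The antipode of `gr H` sends the class of `a ∈ H_n` in `H_n / H_{n-1}` to the class of
`S(a)`. -/
instance [IsPointed k H] : HopfAlgebraStruct k (Gr k H) where
  antipode := grLift (fun n => grClass n ∘ₗ antipode k) grClass_antipode_eq_zero

theorem antipode_grClass [IsPointed k H] {n : ℕ} {a : H} (ha : a ∈ coradicalFiltration k H n) :
    antipode k (grClass (k := k) n a) = grClass n (antipode k a) :=
  grLift_grClass _ _ ha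

theorem grClass_algebraMap_counit [IsPointed k H] {n : ℕ} {a : H}
    (ha : a ∈ coradicalFiltration k H n) : grClass (k := k) n (algebraMap k H (counit (R := k) a)) =
      algebraMap k (Gr k H) (counit (R := k) (grClass (k := k) n a)) := by
  rw [counit_grClass ha, Algebra.algebraMap_eq_smul_one, map_smul]
  split_ifs with h
  · subst h; rw [grClass_one, Algebra.algebraMap_eq_smul_one]
  · rw [grClass_eq_zero_of_lt (one_mem_coradicalFiltration 0) (by omega), smul_zero, map_zero]

/-- The associated graded Hopf algebra `gr H` of a pointed Hopf algebra `H` with respect to its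
coradical filtration. -/
instance [IsPointed k H] : HopfAlgebra k (Gr k H) where
  mul_antipode_rTensor_comul := by
    refine gr_hom_ext fun n a ha => ?_
    simp only [LinearMap.comp_apply]
    rw [comul_grClass ha]
    have h : (LinearMap.mul' k (Gr k H) ∘ₗ (antipode k).rTensor (Gr k H) ∘ₗ grTensor k H n)
        (comul a) = (grClass n ∘ₗ LinearMap.mul' k H ∘ₗ (antipode k).rTensor H) (comul a) := by
      refine tensorFil_ext (fun i j hij u hu v hv => ?_) (comul_mem_tensorFil ha)
      simp only [LinearMap.comp_apply, grTensor_tmul hij hu hv, LinearMap.rTensor_tmul,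
        LinearMap.mul'_apply, antipode_grClass hu]
      rw [grClass_mul (antipode_mem_coradicalFiltration hu) hv, hij]
    simp only [LinearMap.comp_apply] at h
    rw [h, HopfAlgebra.mul_antipode_rTensor_comul_apply, grClass_algebraMap_counit ha]
    rfl
  mul_antipode_lTensor_comul := by
    refine gr_hom_ext fun n a ha => ?_
    simp only [LinearMap.comp_apply]
    rw [comul_grClass ha]
    have h : (LinearMap.mul' k (Gr k H) ∘ₗ (antipode k).lTensor (Gr k H) ∘ₗ grTensor k H n)
        (comul a) = (grClass n ∘ₗ LinearMap.mul' k H ∘ₗ (antipode k).lTensor H) (comul a) := by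
      refine tensorFil_ext (fun i j hij u hu v hv => ?_) (comul_mem_tensorFil ha)
      simp only [LinearMap.comp_apply, grTensor_tmul hij hu hv, LinearMap.lTensor_tmul,
        LinearMap.mul'_apply, antipode_grClass hv]
      rw [grClass_mul hu (antipode_mem_coradicalFiltration hv), hij]
    simp only [LinearMap.comp_apply] at h
    rw [h, HopfAlgebra.mul_antipode_lTensor_comul_apply, grClass_algebraMap_counit ha]
    rfl

end AssociatedGraded

section Invariant

open Coalgebra HopfAlgebra

variable (k : Type*) [Field k] (H : Type*) [Ring H] [HopfAlgebra k H]

variable {k H} in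
/-- The space `P_{x,y}(H) = {h | Δ(h) = h ⊗ x + y ⊗ h}` of `(x, y)`-skew-primitive elements. -/
def skewPrimitive (x y : GroupLike k H) : Submodule k H where
  carrier := {h | comul (R := k) h = h ⊗ₜ[k] (x : H) + (y : H) ⊗ₜ[k] h}
  zero_mem' := by simp
  add_mem' {a b} ha hb := by
    rw [Set.mem_ofPred_eq] at *
    rw [map_add, ha, hb, TensorProduct.add_tmul, TensorProduct.tmul_add]; abel
  smul_mem' c a ha := by
    rw [Set.mem_ofPred_eq] at *
    rw [map_smul, ha, smul_add, TensorProduct.smul_tmul', TensorProduct.tmul_smul]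

variable {k H} in
/-- The subgroup of the group-like elements `g` that centralise `P_{x,1}(H)`, that is,
`g h g⁻¹ = h` for all `h ∈ P_{x,1}(H)`. -/
def skewCentralizer (x : GroupLike k H) : Subgroup (GroupLike k H) where
  carrier := {g | ∀ h ∈ skewPrimitive x 1, (g : H) * h * ((g⁻¹ : GroupLike k H) : H) = h}
  one_mem' h _ := by simp
  mul_mem' {a b} ha hb h hh := by
    have e : ((a * b : GroupLike k H) : H) * h * (((a * b)⁻¹ : GroupLike k H) : H) =
        (a : H) * ((b : H) * h * ((b⁻¹ : GroupLike k H) : H)) * ((a⁻¹ : GroupLike k H) : H) := by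
      rw [mul_inv_rev]; simp only [GroupLike.val_mul, mul_assoc]
    rw [e, hb h hh, ha h hh]
  inv_mem' {a} ha h hh := by
    have e : ((a⁻¹ : GroupLike k H) : H) * (a : H) = 1 := by
      rw [← GroupLike.val_mul, inv_mul_cancel, GroupLike.val_one]
    conv_lhs => rw [← ha h hh]
    rw [inv_inv]
    calc _ = (((a⁻¹ : GroupLike k H) : H) * (a : H)) * h *
          (((a⁻¹ : GroupLike k H) : H) * (a : H)) := by simp only [mul_assoc]
      _ = h := by rw [e, one_mul, mul_one]

variable {k H} in
/-- `a_x = |⟨x⟩ : C_{⟨x⟩}(P_{x,1}(H))|`, where `⟨x⟩` acts on `P_{x,1}(H)` by conjugation, with the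
convention that `a_x = 0` if this index is infinite. -/
def conjIndex (x : GroupLike k H) : ℕ :=
  (skewCentralizer x).relIndex (Subgroup.zpowers x)

/-- `m_H = lcm {a_x | x ∈ G(H)}`: the least positive integer that is a multiple of every `a_x`,
and `∞` if there is none (which is also the case if some `a_x` is infinite: the only multiple
of `a_x = 0` is `0`). -/
def skewInvariant : ℕ∞ :=
  sInf {N | ∃ n : ℕ, N = n ∧ 0 < n ∧ ∀ x : GroupLike k H, conjIndex x ∣ n}

/-- The order `|S|` of the antipode: the least positive `n` with `S^n = id`, and `∞` if there is
none. -/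
def antipodeOrder : ℕ∞ :=
  sInf {N | ∃ n : ℕ, N = n ∧ 0 < n ∧ (antipode k : Module.End k H) ^ n = 1}

end Invariant

end PointedHopf

end

/-!
Let `A = gr H`. An even power `S^{2n}` of an antipode is a coalgebra endomorphism fixing every
group-like element, and on `P_{x,1}` it is conjugation by `x^n`
(`antipode_pow_skewPrimitive`). Hence `S^{2n}` is the identity on every `P_{x,1}` if and only if
every index `a_x` divides `n` (`conjIndex_dvd_iff`).

For `A` this decides whether `S^{2n} = id`. By the theorem of Taft and Wilson
(`coradicalFiltration_one_le`), `H_1` is spanned by `H_0` and the products `gp` with `g` group-like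
and `p` skew-primitive, so if `S_A^{2n}` fixes the classes of the skew-primitive elements of `H`,
then it fixes `A(0)` and `A(1)`. It then fixes every `A(m)`, because a class in `A(m)`, `m ≥ 2`, is
determined by the component of its coproduct in `A(1) ⊗ A(m-1)` (`map_sub_mem_shiftFil`). Since
skew-primitive elements of `H` have skew-primitive classes in `A`, it follows that `S_A^{2n} = id`
if all `a_x` of `H` divide `n`, and if and only if all `a_x` of `A` divide `n`
(`antipode_gr_pow_eq_one_iff`). The first statement gives `m_A < ∞`, the second that `2 m_A` is the
least even period of `S_A`. If `S_A` has an odd period, then the identity is an anti-homomorphism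
of `A`, so `A` is commutative, all conjugations are trivial, `S_A² = id` and thus `S_A = id`
(`antipode_gr_eq_id_of_pow_odd`).
-/

noncomputable section

namespace PointedHopf

open scoped TensorProduct
open Coalgebra HopfAlgebra

/-! ### Skew-primitive elements generate the first step of the coradical filtration -/

section LinearAlgebra

variable {k : Type*} [Field k] {V W ι : Type*} [AddCommGroup V] [Module k V]
  [AddCommGroup W] [Module k W]

theorem exists_eq_sum_tmul_left (v : ι → V) {t : V ⊗[k] W}
    (ht : t ∈ tensorSub (Submodule.span k (Set.range v)) ⊤) :
    ∃ f : ι →₀ W, t = f.sum fun i w => v i ⊗ₜ[k] w := by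
  have h : tensorSub (Submodule.span k (Set.range v)) (⊤ : Submodule k W) ≤
      LinearMap.range (Finsupp.lsum k fun i => TensorProduct.mk k V W (v i)) := by
    refine tensorSub_le.2 fun a ha b _ => ?_
    induction ha using Submodule.span_induction with
    | mem x hx => obtain ⟨i, rfl⟩ := hx; exact ⟨Finsupp.single i b, by simp⟩
    | zero => rw [TensorProduct.zero_tmul]; exact Submodule.zero_mem _
    | add x y _ _ hx hy => rw [TensorProduct.add_tmul]; exact Submodule.add_mem _ hx hy
    | smul c x _ hx => rw [← TensorProduct.smul_tmul']; exact Submodule.smul_mem _ c hx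
  obtain ⟨f, rfl⟩ := h ht
  exact ⟨f, rfl⟩

theorem exists_eq_sum_tmul_right (v : ι → W) {t : V ⊗[k] W}
    (ht : t ∈ tensorSub ⊤ (Submodule.span k (Set.range v))) :
    ∃ f : ι →₀ V, t = f.sum fun i w => w ⊗ₜ[k] v i := by
  have h : tensorSub (⊤ : Submodule k V) (Submodule.span k (Set.range v)) ≤
      LinearMap.range (Finsupp.lsum k fun i => (TensorProduct.mk k V W).flip (v i)) := by
    refine tensorSub_le.2 fun b _ a ha => ?_
    induction ha using Submodule.span_induction with
    | mem x hx => obtain ⟨i, rfl⟩ := hx; exact ⟨Finsupp.single i b, by simp⟩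
    | zero => rw [TensorProduct.tmul_zero]; exact Submodule.zero_mem _
    | add x y _ _ hx hy => rw [TensorProduct.tmul_add]; exact Submodule.add_mem _ hx hy
    | smul c x _ hx => rw [TensorProduct.tmul_smul]; exact Submodule.smul_mem _ c hx
  obtain ⟨f, rfl⟩ := h ht
  exact ⟨f, rfl⟩

/-- A functional dual to one member of a linearly independent family. -/
theorem exists_dual_family {v : ι → V} (hv : LinearIndependent k v) (i : ι) :
    ∃ e : V →ₗ[k] k, e (v i) = 1 ∧ ∀ j, j ≠ i → e (v j) = 0 := by
  obtain ⟨e, he⟩ := LinearMap.exists_extend (Finsupp.lapply i ∘ₗ hv.repr)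
  have h : ∀ j, e (v j) = Finsupp.single j (1 : k) i := fun j => by
    have := LinearMap.congr_fun he ⟨v j, Submodule.subset_span ⟨j, rfl⟩⟩
    simpa only [LinearMap.comp_apply, hv.repr_eq_single j ⟨v j, _⟩ rfl] using! this
  exact ⟨e, by simp [h], fun j hj => by simp [h, hj]⟩

end LinearAlgebra

section Coalgebra

variable {k : Type*} [Field k] {C : Type*} [AddCommGroup C] [Module k C] [Coalgebra k C]

/-- The map `a ↦ ∑ e(a₁) a₂` given by a functional `e` on a coalgebra. -/
def sliceLeft (e : C →ₗ[k] k) : C →ₗ[k] C :=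
  (TensorProduct.lid k C).toLinearMap ∘ₗ e.rTensor C ∘ₗ comul

/-- The map `a ↦ ∑ a₁ e(a₂)` given by a functional `e` on a coalgebra. -/
def sliceRight (e : C →ₗ[k] k) : C →ₗ[k] C :=
  (TensorProduct.rid k C).toLinearMap ∘ₗ e.lTensor C ∘ₗ comul

theorem sliceLeft_groupLike (e : C →ₗ[k] k) (g : GroupLike k C) :
    sliceLeft e (g : C) = e g • (g : C) := by
  simp [sliceLeft]

theorem sliceRight_groupLike (e : C →ₗ[k] k) (g : GroupLike k C) :
    sliceRight e (g : C) = e g • (g : C) := by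
  simp [sliceRight]

/-- `sliceLeft e` is a homomorphism of right comodules. -/
theorem comul_sliceLeft (e : C →ₗ[k] k) (a : C) :
    comul (R := k) (sliceLeft e a) = (sliceLeft e).rTensor C (comul a) := by
  have h1 : comul (R := k) ∘ₗ (TensorProduct.lid k C).toLinearMap ∘ₗ e.rTensor C =
      (TensorProduct.lid k (C ⊗[k] C)).toLinearMap ∘ₗ e.rTensor (C ⊗[k] C) ∘ₗ
        (comul (R := k)).lTensor C := by
    ext x y; simp
  have h2 : (TensorProduct.lid k (C ⊗[k] C)).toLinearMap ∘ₗ e.rTensor (C ⊗[k] C) ∘ₗ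
      (TensorProduct.assoc k C C C).toLinearMap =
        ((TensorProduct.lid k C).toLinearMap ∘ₗ e.rTensor C).rTensor C := by
    ext x y z; simp [TensorProduct.smul_tmul']
  have h3 := LinearMap.congr_fun h1 (comul (R := k) a)
  have h4 := LinearMap.congr_fun h2 ((comul (R := k)).rTensor C (comul (R := k) a))
  simp only [LinearMap.comp_apply, LinearEquiv.coe_coe] at h3 h4
  rw [← LinearMap.rTensor_comp_apply] at h4
  simp only [sliceLeft, LinearMap.comp_apply, LinearEquiv.coe_coe]
  rw [h3, ← Coalgebra.coassoc_apply, h4]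
  rfl

/-- `sliceRight e` is a homomorphism of left comodules. -/
theorem comul_sliceRight (e : C →ₗ[k] k) (a : C) :
    comul (R := k) (sliceRight e a) = (sliceRight e).lTensor C (comul a) := by
  have h1 : comul (R := k) ∘ₗ (TensorProduct.rid k C).toLinearMap ∘ₗ e.lTensor C =
      (TensorProduct.rid k (C ⊗[k] C)).toLinearMap ∘ₗ e.lTensor (C ⊗[k] C) ∘ₗ
        (comul (R := k)).rTensor C := by
    ext x y; simp
  have h2 : (TensorProduct.rid k (C ⊗[k] C)).toLinearMap ∘ₗ e.lTensor (C ⊗[k] C) ∘ₗ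
      (TensorProduct.assoc k C C C).symm.toLinearMap =
        ((TensorProduct.rid k C).toLinearMap ∘ₗ e.lTensor C).lTensor C := by
    ext x y z; simp
  have h3 := LinearMap.congr_fun h1 (comul (R := k) a)
  have h4 := LinearMap.congr_fun h2 ((comul (R := k)).lTensor C (comul (R := k) a))
  simp only [LinearMap.comp_apply, LinearEquiv.coe_coe] at h3 h4
  rw [← LinearMap.lTensor_comp_apply] at h4
  simp only [sliceRight, LinearMap.comp_apply, LinearEquiv.coe_coe]
  rw [h3, ← Coalgebra.coassoc_symm_apply, h4]
  rfl

variable (k C) in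
/-- The span of the group-like elements. -/
def groupLikeSpan : Submodule k C := Submodule.span k (Set.range (GroupLike.val (R := k) (A := C)))

/-- If `Δ(a) = ∑ g ⊗ f(g) + z` with `z ∈ C ⊗ Y`, then `a = ∑ f(g)` modulo `Y`. For a functional `e`
dual to `g` among the group-like elements, `f(g)` agrees modulo `Y` with `∑ e(a₁) a₂`, and this
element lies in `kg ∧ Y`. -/
theorem wedge_groupLikeSpan_left_le (Y : Submodule k C) :
    wedge (groupLikeSpan k C) Y ≤ Y ⊔ ⨆ g : GroupLike k C, wedge (Submodule.span k {(g : C)}) Y := by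
  intro a ha
  obtain ⟨u, hu, z, hz, huz⟩ := Submodule.mem_sup.1 (mem_wedge.1 ha)
  obtain ⟨f, rfl⟩ := exists_eq_sum_tmul_left _ hu
  have hzY : ∀ e : C →ₗ[k] k, TensorProduct.lid k C (e.rTensor C z) ∈ Y := by
    intro e
    refine (tensorSub_le (P := Y.comap ((TensorProduct.lid k C).toLinearMap ∘ₗ e.rTensor C))).2
      (fun x _ y hy => ?_) hz
    simpa using Y.smul_mem (e x) hy
  have hslice : ∀ e : C →ₗ[k] k, sliceLeft e a =
      (f.sum fun g c => e g • c) + TensorProduct.lid k C (e.rTensor C z) := by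
    intro e
    simp [sliceLeft, ← huz, Finsupp.sum, map_sum]
  have hf : ∀ g : GroupLike k C,
      f g ∈ Y ⊔ ⨆ g : GroupLike k C, wedge (Submodule.span k {(g : C)}) Y := by
    intro g
    obtain ⟨e, he1, he0⟩ := exists_dual_family (linearIndep_groupLikeVal (R := k) (A := C)) g
    have h1 : (f.sum fun g c => e g • c) = f g := by
      rw [Finsupp.sum, Finset.sum_eq_single g (fun h _ hne => by rw [he0 h hne, zero_smul])
        (fun hn => by rw [Finsupp.notMem_support_iff.1 hn, smul_zero]), he1, one_smul]
    have h2 : sliceLeft e a ∈ wedge (Submodule.span k {(g : C)}) Y := by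
      rw [mem_wedge, comul_sliceLeft, ← huz, map_add]
      refine Submodule.add_mem_sup ?_
        (map_mem_tensorSub (g := LinearMap.id) (fun _ _ => Submodule.mem_top) (fun _ h => h) hz)
      rw [Finsupp.sum, map_sum]
      refine Submodule.sum_mem _ fun h _ => ?_
      rw [LinearMap.rTensor_tmul, sliceLeft_groupLike]
      rcases eq_or_ne h g with rfl | hne
      · exact tmul_mem_tensorSub (Submodule.smul_mem _ _ (Submodule.mem_span_singleton_self _))
          trivial
      · rw [he0 h hne, zero_smul, TensorProduct.zero_tmul]; exact Submodule.zero_mem _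
    rw [← h1, ← add_sub_cancel_right (f.sum fun g c => e g • c)
      (TensorProduct.lid k C (e.rTensor C z)), ← hslice]
    exact Submodule.sub_mem _ (Submodule.mem_sup_right (Submodule.mem_iSup_of_mem g h2))
      (Submodule.mem_sup_left (hzY e))
  have ha' : a = (f.sum fun _ c => c) + TensorProduct.lid k C ((counit (R := k)).rTensor C z) := by
    have := hslice (counit (R := k))
    simpa [sliceLeft] using this
  rw [ha']
  exact Submodule.add_mem _ (Submodule.sum_mem _ fun g _ => hf g) (Submodule.mem_sup_left (hzY _))

/-- The mirror image of `wedge_groupLikeSpan_left_le`. -/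
theorem wedge_groupLikeSpan_right_le (X : Submodule k C) :
    wedge X (groupLikeSpan k C) ≤ X ⊔ ⨆ g : GroupLike k C, wedge X (Submodule.span k {(g : C)}) := by
  intro a ha
  obtain ⟨z, hz, u, hu, huz⟩ := Submodule.mem_sup.1 (mem_wedge.1 ha)
  obtain ⟨f, rfl⟩ := exists_eq_sum_tmul_right _ hu
  have hzX : ∀ e : C →ₗ[k] k, TensorProduct.rid k C (e.lTensor C z) ∈ X := by
    intro e
    refine (tensorSub_le (P := X.comap ((TensorProduct.rid k C).toLinearMap ∘ₗ e.lTensor C))).2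
      (fun x hx y _ => ?_) hz
    simpa using X.smul_mem (e y) hx
  have hslice : ∀ e : C →ₗ[k] k, sliceRight e a =
      TensorProduct.rid k C (e.lTensor C z) + f.sum fun g c => e g • c := by
    intro e
    simp [sliceRight, ← huz, Finsupp.sum, map_sum]
  have hf : ∀ g : GroupLike k C,
      f g ∈ X ⊔ ⨆ g : GroupLike k C, wedge X (Submodule.span k {(g : C)}) := by
    intro g
    obtain ⟨e, he1, he0⟩ := exists_dual_family (linearIndep_groupLikeVal (R := k) (A := C)) g
    have h1 : (f.sum fun g c => e g • c) = f g := by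
      rw [Finsupp.sum, Finset.sum_eq_single g (fun h _ hne => by rw [he0 h hne, zero_smul])
        (fun hn => by rw [Finsupp.notMem_support_iff.1 hn, smul_zero]), he1, one_smul]
    have h2 : sliceRight e a ∈ wedge X (Submodule.span k {(g : C)}) := by
      rw [mem_wedge, comul_sliceRight, ← huz, map_add]
      refine Submodule.add_mem_sup
        (map_mem_tensorSub (f := LinearMap.id) (fun _ h => h) (fun _ _ => Submodule.mem_top) hz) ?_
      rw [Finsupp.sum, map_sum]
      refine Submodule.sum_mem _ fun h _ => ?_
      rw [LinearMap.lTensor_tmul, sliceRight_groupLike]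
      rcases eq_or_ne h g with rfl | hne
      · exact tmul_mem_tensorSub trivial
          (Submodule.smul_mem _ _ (Submodule.mem_span_singleton_self _))
      · rw [he0 h hne, zero_smul, TensorProduct.tmul_zero]; exact Submodule.zero_mem _
    rw [← h1, ← add_sub_cancel_left (TensorProduct.rid k C (e.lTensor C z))
      (f.sum fun g c => e g • c), ← hslice]
    exact Submodule.sub_mem _ (Submodule.mem_sup_right (Submodule.mem_iSup_of_mem g h2))
      (Submodule.mem_sup_left (hzX e))
  have ha' : a = TensorProduct.rid k C ((counit (R := k)).lTensor C z) + f.sum fun _ c => c := by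
    have := hslice (counit (R := k))
    simpa [sliceRight] using this
  rw [ha']
  exact Submodule.add_mem _ (Submodule.mem_sup_left (hzX _)) (Submodule.sum_mem _ fun g _ => hf g)

/-- Subtracting a multiple of `g` turns an element of `kg ∧ kh` into an
`(h, g)`-skew-primitive one. -/
theorem exists_comul_sub_smul {g h : GroupLike k C} {a : C}
    (ha : a ∈ wedge (Submodule.span k {(g : C)}) (Submodule.span k {(h : C)})) :
    ∃ t : k, comul (R := k) (a - t • (g : C)) =
      (a - t • (g : C)) ⊗ₜ[k] (h : C) + (g : C) ⊗ₜ[k] (a - t • (g : C)) := by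
  obtain ⟨u, hu, v, hv, huv⟩ := Submodule.mem_sup.1 (mem_wedge.1 ha)
  obtain ⟨c, rfl⟩ : ∃ c : C, u = (g : C) ⊗ₜ[k] c := by
    refine (tensorSub_le (P := LinearMap.range (TensorProduct.mk k C C (g : C)))).2
      (fun x hx y _ => ?_) hu |>.imp fun _ h => h.symm
    obtain ⟨s, rfl⟩ := Submodule.mem_span_singleton.1 hx
    exact ⟨s • y, by simp [TensorProduct.smul_tmul]⟩
  obtain ⟨b, rfl⟩ : ∃ b : C, v = b ⊗ₜ[k] (h : C) := by
    refine (tensorSub_le (P := LinearMap.range ((TensorProduct.mk k C C).flip (h : C)))).2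
      (fun x _ y hy => ?_) hv |>.imp fun _ h => h.symm
    obtain ⟨s, rfl⟩ := Submodule.mem_span_singleton.1 hy
    exact ⟨s • x, by simp [TensorProduct.smul_tmul']⟩
  have h1 : c + counit (R := k) b • (h : C) = a := by
    have := Coalgebra.rTensor_counit_comul (R := k) a
    rw [← huv] at this
    simpa using congrArg (TensorProduct.lid k C) this
  have h2 : counit (R := k) c • (g : C) + b = a := by
    have := Coalgebra.lTensor_counit_comul (R := k) a
    rw [← huv] at this
    simpa using congrArg (TensorProduct.rid k C) this
  have hc : c = a - counit (R := k) b • (h : C) := eq_sub_of_add_eq h1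
  have hb : b = a - counit (R := k) c • (g : C) := eq_sub_of_add_eq' h2
  refine ⟨counit (R := k) c + counit (R := k) b, ?_⟩
  generalize counit (R := k) c = γ at *
  generalize counit (R := k) b = β at *
  rw [map_sub, ← huv, map_smul, g.isGroupLikeElem_val.comul_eq_tmul_self, hc, hb]
  simp only [TensorProduct.tmul_sub, TensorProduct.sub_tmul, TensorProduct.tmul_smul,
    ← TensorProduct.smul_tmul', add_smul, TensorProduct.add_tmul, TensorProduct.tmul_add]
  abel

end Coalgebra

section Hopf

variable {k : Type*} [Field k] {H : Type*} [Ring H] [HopfAlgebra k H]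

theorem inv_mul_mem_skewPrimitive {g x : GroupLike k H} {a : H}
    (ha : comul (R := k) a = a ⊗ₜ[k] (x : H) + (g : H) ⊗ₜ[k] a) :
    ((g⁻¹ : GroupLike k H) : H) * a ∈ skewPrimitive (g⁻¹ * x) 1 := by
  change comul (R := k) _ = _
  have e : ((g⁻¹ : GroupLike k H) : H) * (g : H) = 1 := by
    rw [← GroupLike.val_mul, inv_mul_cancel, GroupLike.val_one]
  rw [Bialgebra.comul_mul, ha, (g⁻¹).isGroupLikeElem_val.comul_eq_tmul_self, mul_add,
    Algebra.TensorProduct.tmul_mul_tmul, Algebra.TensorProduct.tmul_mul_tmul, e,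
    GroupLike.val_mul, GroupLike.val_one]

/-- The theorem of Taft and Wilson, as an induction principle: the first step of the coradical
filtration of a pointed Hopf algebra is spanned by the coradical and the translates `gp` of
skew-primitive elements by group-like elements. -/
theorem coradicalFiltration_one_le [IsPointed k H] {P : Submodule k H}
    (h0 : coradicalFiltration k H 0 ≤ P)
    (h1 : ∀ g x : GroupLike k H, ∀ p ∈ skewPrimitive x 1, (g : H) * p ∈ P) :
    coradicalFiltration k H 1 ≤ P := by
  have e : coradicalFiltration k H 0 = groupLikeSpan k H := by
    change coradical k H = _
    rw [IsPointed.coradical_eq_span, groupLikeSpan]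
    congr 1
    ext g
    exact ⟨fun hg => ⟨⟨g, hg⟩, rfl⟩, by rintro ⟨g, rfl⟩; exact g.2⟩
  have hG : ∀ g : GroupLike k H, (g : H) ∈ P := fun g => h0 (IsPointed.mem_coradical g.2)
  rw [coradicalFiltration_succ, e]
  refine (wedge_groupLikeSpan_left_le _).trans (sup_le (e ▸ h0) (iSup_le fun g => ?_))
  refine (wedge_groupLikeSpan_right_le _).trans (sup_le ?_ (iSup_le fun h => ?_))
  · exact (Submodule.span_singleton_le_iff_mem _ _).2 (hG g)
  · intro a ha
    obtain ⟨t, ht⟩ := exists_comul_sub_smul ha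
    have := h1 g _ _ (inv_mul_mem_skewPrimitive ht)
    rw [← mul_assoc, ← GroupLike.val_mul, mul_inv_cancel, GroupLike.val_one, one_mul] at this
    rw [← sub_add_cancel a (t • (g : H))]
    exact P.add_mem this (P.smul_mem t (hG g))

end Hopf

/-! ### Powers of the antipode -/

section AntipodePow

variable {k : Type*} [Field k] {H : Type*} [Ring H] [HopfAlgebra k H]

theorem antipode_pow_succ_apply (n : ℕ) (a : H) :
    ((antipode k : Module.End k H) ^ (n + 1)) a =
      antipode k (((antipode k : Module.End k H) ^ n) a) := by
  rw [pow_succ', Module.End.mul_apply]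

theorem antipode_pow_two_mul_succ_apply (n : ℕ) (a : H) :
    ((antipode k : Module.End k H) ^ (2 * (n + 1))) a =
      antipode k (antipode k (((antipode k : Module.End k H) ^ (2 * n)) a)) := by
  rw [show 2 * (n + 1) = 2 * n + 1 + 1 by ring, antipode_pow_succ_apply, antipode_pow_succ_apply]

theorem antipode_pow_two_mul_mul (n : ℕ) (a b : H) :
    ((antipode k : Module.End k H) ^ (2 * n)) (a * b) =
      ((antipode k : Module.End k H) ^ (2 * n)) a * ((antipode k : Module.End k H) ^ (2 * n)) b := by
  induction n with
  | zero => simp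
  | succ n ih => simp only [antipode_pow_two_mul_succ_apply, ih, antipode_mul_antidistrib]

theorem comul_antipode_pow_two_mul (n : ℕ) (a : H) :
    comul (R := k) (((antipode k : Module.End k H) ^ (2 * n)) a) =
      TensorProduct.map ((antipode k : Module.End k H) ^ (2 * n))
        ((antipode k : Module.End k H) ^ (2 * n)) (comul a) := by
  induction n with
  | zero =>
    rw [mul_zero, pow_zero]
    change _ = TensorProduct.map LinearMap.id LinearMap.id (comul (R := k) a)
    rw [TensorProduct.map_id]; rfl
  | succ n ih =>
    rw [antipode_pow_two_mul_succ_apply, comul_antipode, comul_antipode, ih]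
    generalize comul (R := k) a = t
    induction t using TensorProduct.induction_on with
    | zero => simp
    | tmul x y => simp [antipode_pow_two_mul_succ_apply]
    | add x y hx hy => simp only [map_add, hx, hy]

theorem antipode_pow_two_mul_groupLike (n : ℕ) {g : H} (hg : IsGroupLikeElem k g) :
    ((antipode k : Module.End k H) ^ (2 * n)) g = g := by
  induction n with
  | zero => simp
  | succ n ih => rw [antipode_pow_two_mul_succ_apply, ih, hg.antipode_antipode]

theorem antipode_skewPrimitive {x : GroupLike k H} {p : H} (hp : p ∈ skewPrimitive x 1) :
    antipode k p = -(p * ((x⁻¹ : GroupLike k H) : H)) := by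
  have hp' : comul (R := k) p = p ⊗ₜ[k] (x : H) + ((1 : GroupLike k H) : H) ⊗ₜ[k] p := hp
  have hε : counit (R := k) p = 0 := by
    have := Coalgebra.rTensor_counit_comul (R := k) p
    rw [hp'] at this
    have := congrArg (counit (R := k) ∘ₗ (TensorProduct.lid k H).toLinearMap) this
    simpa using this
  have h := mul_antipode_lTensor_comul_apply (R := k) p
  rw [hp', hε] at h
  simp only [map_add, LinearMap.lTensor_tmul, LinearMap.mul'_apply, GroupLike.val_one, one_mul,
    map_zero] at h
  exact eq_neg_of_add_eq_zero_right h

/-- On `P_{x,1}` the square of the antipode is conjugation by `x`. -/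
theorem antipode_antipode_skewPrimitive {x : GroupLike k H} {p : H}
    (hp : p ∈ skewPrimitive x 1) :
    antipode k (antipode k p) = (x : H) * p * ((x⁻¹ : GroupLike k H) : H) := by
  rw [antipode_skewPrimitive hp, map_neg, antipode_mul_antidistrib, antipode_skewPrimitive hp,
    ← GroupLike.val_inv, inv_inv, mul_neg, neg_neg, mul_assoc]

theorem antipode_pow_skewPrimitive (n : ℕ) {x : GroupLike k H} {p : H}
    (hp : p ∈ skewPrimitive x 1) : ((antipode k : Module.End k H) ^ (2 * n)) p =
      ((x ^ n : GroupLike k H) : H) * p * (((x ^ n)⁻¹ : GroupLike k H) : H) := by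
  induction n with
  | zero => simp
  | succ n ih =>
    rw [antipode_pow_two_mul_succ_apply, ih]
    have e : ∀ g : GroupLike k H, antipode k (antipode k (g : H)) = g :=
      fun g => g.isGroupLikeElem_val.antipode_antipode
    rw [antipode_mul_antidistrib, antipode_mul_antidistrib, antipode_mul_antidistrib,
      antipode_mul_antidistrib, e, e, antipode_antipode_skewPrimitive hp, pow_succ, mul_inv_rev]
    simp only [GroupLike.val_mul, mul_assoc]

/-- Odd powers of the antipode are anti-homomorphisms; if one of them is the identity, the
multiplication is commutative. -/
theorem mul_comm_of_antipode_pow_odd {n : ℕ} (hn : Odd n)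
    (h : (antipode k : Module.End k H) ^ n = 1) (a b : H) : a * b = b * a := by
  obtain ⟨m, rfl⟩ := hn
  have := antipode_pow_succ_apply (k := k) (2 * m) (a * b)
  rw [antipode_pow_two_mul_mul, antipode_mul_antidistrib, ← antipode_pow_succ_apply,
    ← antipode_pow_succ_apply, h] at this
  exact this

theorem antipode_pow_mem_coradicalFiltration [IsPointed k H] (m : ℕ) {n : ℕ} {a : H}
    (ha : a ∈ coradicalFiltration k H n) :
    ((antipode k : Module.End k H) ^ m) a ∈ coradicalFiltration k H n := by
  induction m with
  | zero => simpa using ha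
  | succ m ih => rw [antipode_pow_succ_apply]; exact antipode_mem_coradicalFiltration ih

theorem antipode_pow_coradical [IsPointed k H] (m : ℕ) {a : H}
    (ha : a ∈ coradicalFiltration k H 0) : ((antipode k : Module.End k H) ^ (2 * m)) a = a :=
  IsPointed.coradical_induction
    (P := LinearMap.eqLocus ((antipode k : Module.End k H) ^ (2 * m)) LinearMap.id)
    (fun _ hg => antipode_pow_two_mul_groupLike m hg) ha

end AntipodePow

/-! ### Coalgebra endomorphisms that are the identity in degrees `0` and `1` -/

section Coalgebra

variable {k : Type*} [Field k] {C : Type*} [AddCommGroup C] [Module k C] [Coalgebra k C]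

/-- A filtered coalgebra endomorphism that induces the identity in degrees `0` and `1` of the
associated graded coalgebra induces the identity in every degree: for `a ∈ C_n` with `n ≥ 2` the
terms of `Δ(φ a - a)` lie in `C_0 ⊗ C + C ⊗ C_{n-2}`, so that `φ a - a ∈ C_0 ∧ C_{n-2} = C_{n-1}`. -/
theorem map_sub_mem_shiftFil {φ : C →ₗ[k] C}
    (hφ : ∀ a, comul (R := k) (φ a) = TensorProduct.map φ φ (comul a))
    (hfil : ∀ n, ∀ a ∈ coradicalFiltration k C n, φ a ∈ coradicalFiltration k C n)
    (h0 : ∀ a ∈ coradicalFiltration k C 0, φ a = a)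
    (h1 : ∀ a ∈ coradicalFiltration k C 1, φ a - a ∈ coradicalFiltration k C 0) (n : ℕ) {a : C}
    (ha : a ∈ coradicalFiltration k C n) : φ a - a ∈ shiftFil (coradicalFiltration k C) n := by
  induction n using Nat.strong_induction_on generalizing a with
  | _ n ih =>
  rcases n with _ | _ | n
  · rw [h0 a ha, sub_self]; exact Submodule.zero_mem _
  · exact h1 a ha
  · change φ a - a ∈ coradicalFiltration k C (n + 1)
    rw [coradicalFiltration_succ, mem_wedge, map_sub, hφ]
    set P := tensorSub (coradicalFiltration k C 0) ⊤ ⊔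
      tensorSub ⊤ (coradicalFiltration k C n) with hP
    refine (tensorFil_le (P := P.comap (TensorProduct.map φ φ - LinearMap.id))).2 ?_
      (comul_mem_tensorFil ha)
    intro i j hij u hu v hv
    change φ u ⊗ₜ[k] φ v - u ⊗ₜ[k] v ∈ P
    rcases i with _ | _ | i
    · rw [h0 u hu, ← TensorProduct.tmul_sub]
      exact Submodule.mem_sup_left (tmul_mem_tensorSub hu trivial)
    · have e : φ u ⊗ₜ[k] φ v - u ⊗ₜ[k] v = (φ u - u) ⊗ₜ[k] φ v + u ⊗ₜ[k] (φ v - v) := by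
        rw [TensorProduct.sub_tmul, TensorProduct.tmul_sub]; abel
      -- The induction hypothesis applies to `v`, which has degree `n + 1`.
      rw [e]
      obtain rfl : j = n + 1 := by omega
      exact Submodule.add_mem_sup (tmul_mem_tensorSub (h1 u hu) trivial)
        (tmul_mem_tensorSub trivial (ih (n + 1) (by omega) hv))
    · have hj : j ≤ n := by omega
      refine Submodule.mem_sup_right (Submodule.sub_mem _ ?_ ?_)
      · exact tmul_mem_tensorSub trivial (coradicalFiltration_mono hj (hfil j v hv))
      · exact tmul_mem_tensorSub trivial (coradicalFiltration_mono hj hv)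

end Coalgebra

/-! ### The antipode of the associated graded Hopf algebra -/

section Graded

variable {k : Type*} [Field k] {H : Type*} [Ring H] [HopfAlgebra k H]

/-- The kernel of the class map on `H_n` is `H_{n-1}`, the converse of `grClass_eq_zero`. -/
theorem mem_shiftFil_of_grClass_eq_zero {n : ℕ} {a : H} (ha : a ∈ coradicalFiltration k H n)
    (h : grClass (k := k) n a = 0) : a ∈ shiftFil (coradicalFiltration k H) n := by
  rw [grClass_eq ha] at h
  have h' : symb n ⟨a, ha⟩ = 0 :=
    DirectSum.of_injective n (h.trans (map_zero (DirectSum.of (GrPiece k H) n)).symm)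
  exact (Submodule.Quotient.mk_eq_zero ((shiftFil (coradicalFiltration k H) n).submoduleOf
    (coradicalFiltration k H n))).1 h'

variable [IsPointed k H]

theorem antipode_pow_grClass (m : ℕ) {n : ℕ} {a : H} (ha : a ∈ coradicalFiltration k H n) :
    ((antipode k : Module.End k (Gr k H)) ^ m) (grClass n a) =
      grClass n (((antipode k : Module.End k H) ^ m) a) := by
  induction m with
  | zero => simp
  | succ m ih =>
    rw [antipode_pow_succ_apply, ih, antipode_grClass (antipode_pow_mem_coradicalFiltration m ha),
      antipode_pow_succ_apply]

theorem mem_coradicalFiltration_one_of_mem_skewPrimitive {x : GroupLike k H} {p : H}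
    (hp : p ∈ skewPrimitive x 1) : p ∈ coradicalFiltration k H 1 := by
  have hp' : comul (R := k) p = p ⊗ₜ[k] (x : H) + ((1 : GroupLike k H) : H) ⊗ₜ[k] p := hp
  rw [coradicalFiltration_succ, mem_wedge, hp', add_comm]
  exact Submodule.add_mem_sup
    (tmul_mem_tensorSub (IsPointed.mem_coradical (GroupLike.isGroupLikeElem_val _)) trivial)
    (tmul_mem_tensorSub trivial (IsPointed.mem_coradical x.2))

/-- The class of a group-like element `x` of `H` in `gr H (0) = H_0`. -/
def grGroupLike (x : GroupLike k H) : GroupLike k (Gr k H) where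
  val := grClass 0 (x : H)
  isGroupLikeElem_val := by
    have hx := IsPointed.mem_coradical x.2
    refine ⟨?_, ?_⟩
    · rw [counit_grClass hx, if_pos rfl, x.2.counit_eq_one]
    · rw [comul_grClass hx, x.2.comul_eq_tmul_self, grTensor_tmul rfl hx hx]

theorem grClass_mem_skewPrimitive {x : GroupLike k H} {p : H} (hp : p ∈ skewPrimitive x 1) :
    grClass (k := k) 1 p ∈ skewPrimitive (grGroupLike x) 1 := by
  have hp' : comul (R := k) p = p ⊗ₜ[k] (x : H) + ((1 : GroupLike k H) : H) ⊗ₜ[k] p := hp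
  have hp1 := mem_coradicalFiltration_one_of_mem_skewPrimitive hp
  change comul (R := k) (grClass (k := k) 1 p) = _
  rw [comul_grClass hp1, hp', map_add, GroupLike.val_one,
    grTensor_tmul rfl hp1 (IsPointed.mem_coradical x.2),
    grTensor_tmul rfl (one_mem_coradicalFiltration 0) hp1, grClass_one]
  rfl

/-- An even power of the antipode of `gr H` is trivial as soon as it fixes the classes of the
skew-primitive elements of `H`, since these generate `gr H (1)` over `gr H (0)`. -/
theorem antipode_gr_pow_eq_one {n : ℕ}
    (h : ∀ x : GroupLike k H, ∀ p ∈ skewPrimitive x 1,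
      ((antipode k : Module.End k (Gr k H)) ^ (2 * n)) (grClass 1 p) = grClass 1 p) :
    (antipode k : Module.End k (Gr k H)) ^ (2 * n) = 1 := by
  have h1 : ∀ a ∈ coradicalFiltration k H 1,
      ((antipode k : Module.End k H) ^ (2 * n)) a - a ∈ coradicalFiltration k H 0 := by
    intro a ha
    refine coradicalFiltration_one_le (P := (coradicalFiltration k H 0).comap
      ((antipode k : Module.End k H) ^ (2 * n) - LinearMap.id)) (fun b hb => ?_)
      (fun g x p hp => ?_) ha
    · change ((antipode k : Module.End k H) ^ (2 * n)) b - b ∈ coradicalFiltration k H 0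
      rw [antipode_pow_coradical n hb, sub_self]; exact Submodule.zero_mem _
    · change ((antipode k : Module.End k H) ^ (2 * n)) ((g : H) * p) - (g : H) * p ∈
        coradicalFiltration k H 0
      rw [antipode_pow_two_mul_mul, antipode_pow_two_mul_groupLike n g.2, ← mul_sub]
      have hp1 := mem_coradicalFiltration_one_of_mem_skewPrimitive hp
      refine mul_mem_coradicalFiltration (n := 0) (m := 0) (IsPointed.mem_coradical g.2) ?_
      refine mem_shiftFil_of_grClass_eq_zero (n := 1)
        (Submodule.sub_mem _ (antipode_pow_mem_coradicalFiltration _ hp1) hp1) ?_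
      rw [map_sub, ← antipode_pow_grClass _ hp1, h x p hp, sub_self]
  refine gr_hom_ext fun m a ha => ?_
  rw [antipode_pow_grClass _ ha, Module.End.one_apply, ← sub_eq_zero, ← map_sub]
  exact grClass_eq_zero (map_sub_mem_shiftFil (comul_antipode_pow_two_mul n)
    (fun _ _ => antipode_pow_mem_coradicalFiltration _) (fun _ => antipode_pow_coradical n) h1 m ha)

end Graded

/-! ### The order of the antipode and the conjugation indices -/

section Order

variable {k : Type*} [Field k] {H : Type*} [Ring H] [HopfAlgebra k H]

theorem relIndex_zpowers_dvd_iff {G : Type*} [Group G] (K : Subgroup G) (x : G) (n : ℕ) :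
    K.relIndex (Subgroup.zpowers x) ∣ n ↔ x ^ n ∈ K := by
  have hx : ∀ z : Subgroup.zpowers x, z ∈ Subgroup.zpowers
      (⟨x, Subgroup.mem_zpowers x⟩ : Subgroup.zpowers x) := by
    rintro ⟨_, m, rfl⟩
    exact ⟨m, by ext; simp⟩
  have hq : ∀ z : Subgroup.zpowers x ⧸ K.subgroupOf (Subgroup.zpowers x), z ∈ Subgroup.zpowers
      ((⟨x, Subgroup.mem_zpowers x⟩ : Subgroup.zpowers x) :
        Subgroup.zpowers x ⧸ K.subgroupOf (Subgroup.zpowers x)) := by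
    intro z
    induction z using QuotientGroup.induction_on with
    | H z =>
      obtain ⟨m, rfl⟩ := hx z
      exact ⟨m, by simp⟩
  rw [Subgroup.relIndex, Subgroup.index_eq_card, ← orderOf_eq_card_of_forall_mem_zpowers hq,
    orderOf_dvd_iff_pow_eq_one, ← QuotientGroup.mk_pow, QuotientGroup.eq_one_iff,
    Subgroup.mem_subgroupOf]
  rfl

theorem conjIndex_dvd_iff {x : GroupLike k H} {n : ℕ} : conjIndex x ∣ n ↔
    ∀ p ∈ skewPrimitive x 1, ((antipode k : Module.End k H) ^ (2 * n)) p = p := by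
  rw [conjIndex, relIndex_zpowers_dvd_iff]
  exact forall₂_congr fun p hp => by rw [antipode_pow_skewPrimitive n hp]

variable [IsPointed k H]

theorem antipode_gr_pow_eq_one_of_conjIndex_dvd {n : ℕ}
    (h : ∀ x : GroupLike k H, conjIndex x ∣ n) :
    (antipode k : Module.End k (Gr k H)) ^ (2 * n) = 1 :=
  antipode_gr_pow_eq_one fun x p hp => by
    rw [antipode_pow_grClass _ (mem_coradicalFiltration_one_of_mem_skewPrimitive hp),
      conjIndex_dvd_iff.1 (h x) p hp]

theorem antipode_gr_pow_eq_one_iff {n : ℕ} :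
    (antipode k : Module.End k (Gr k H)) ^ (2 * n) = 1 ↔
      ∀ x : GroupLike k (Gr k H), conjIndex x ∣ n :=
  ⟨fun h _ => conjIndex_dvd_iff.2 fun p _ => by rw [h, Module.End.one_apply],
    fun h => antipode_gr_pow_eq_one fun _ _ hp =>
      conjIndex_dvd_iff.1 (h _) _ (grClass_mem_skewPrimitive hp)⟩

/-- If the antipode of `gr H` has odd order then `gr H` is commutative, so that conjugation is
trivial and the square of the antipode is the identity. -/
theorem antipode_gr_eq_id_of_pow_odd {n : ℕ} (hn : Odd n)
    (h : (antipode k : Module.End k (Gr k H)) ^ n = 1) :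
    (antipode k : Gr k H →ₗ[k] Gr k H) = LinearMap.id := by
  have h2 : (antipode k : Module.End k (Gr k H)) ^ (2 * 1) = 1 := by
    refine antipode_gr_pow_eq_one_iff.2 fun x => ?_
    rw [conjIndex, relIndex_zpowers_dvd_iff]
    intro p _
    rw [mul_comm_of_antipode_pow_odd hn h _ p, mul_assoc, ← GroupLike.val_mul, mul_inv_cancel,
      GroupLike.val_one, mul_one]
  obtain ⟨m, rfl⟩ := hn
  rw [mul_one] at h2
  rwa [pow_succ, pow_mul, h2, one_pow, one_mul] at h

theorem sInf_natCast_lt_top_iff {p : ℕ → Prop} :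
    sInf {N : ℕ∞ | ∃ n : ℕ, N = n ∧ p n} < ⊤ ↔ ∃ n, p n := by
  rw [sInf_lt_iff]
  constructor
  · rintro ⟨_, ⟨n, -, hn⟩, -⟩; exact ⟨n, hn⟩
  · rintro ⟨n, hn⟩; exact ⟨n, ⟨n, rfl, hn⟩, ENat.natCast_lt_top n⟩

theorem sInf_natCast_eq {p : ℕ → Prop} {m : ℕ} (hm : p m) (h : ∀ n, p n → m ≤ n) :
    sInf {N : ℕ∞ | ∃ n : ℕ, N = n ∧ p n} = m :=
  le_antisymm (sInf_le ⟨m, rfl, hm⟩) (le_sInf (by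
    rintro _ ⟨n, rfl, hn⟩; exact_mod_cast h n hn))

end Order

end PointedHopf
end

theorem corollary3p10 (k : Type*) [Field k] (H : Type*) [Ring H] [HopfAlgebra k H]
    [PointedHopf.IsPointed k H] (hm : PointedHopf.skewInvariant k H < ⊤) :
    PointedHopf.skewInvariant k (PointedHopf.Gr k H) < ⊤ ∧
      ((HopfAlgebra.antipode k : PointedHopf.Gr k H →ₗ[k] PointedHopf.Gr k H) = LinearMap.id ∨
        PointedHopf.antipodeOrder k (PointedHopf.Gr k H) =
          2 * PointedHopf.skewInvariant k (PointedHopf.Gr k H)) := by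
  classical
  open PointedHopf in
  obtain ⟨n, hn, hdvd⟩ := sInf_natCast_lt_top_iff.1 hm
  have hex : ∃ n : ℕ, 0 < n ∧ ∀ x : GroupLike k (Gr k H), conjIndex x ∣ n :=
    ⟨n, hn, antipode_gr_pow_eq_one_iff.1 (antipode_gr_pow_eq_one_of_conjIndex_dvd hdvd)⟩
  refine ⟨sInf_natCast_lt_top_iff.2 hex, or_iff_not_imp_left.2 fun hS => ?_⟩
  have hm' : skewInvariant k (Gr k H) = (Nat.find hex : ℕ) :=
    sInf_natCast_eq (Nat.find_spec hex) fun _ => Nat.find_min' hex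
  rw [hm', antipodeOrder, sInf_natCast_eq (m := 2 * Nat.find hex)]
  · push_cast; rfl
  · exact ⟨by have := (Nat.find_spec hex).1; omega,
      antipode_gr_pow_eq_one_iff.2 (Nat.find_spec hex).2⟩
  · rintro l ⟨hl, hSl⟩
    rcases Nat.even_or_odd' l with ⟨m, rfl | rfl⟩
    · exact Nat.mul_le_mul_left 2
        (Nat.find_min' hex ⟨by omega, antipode_gr_pow_eq_one_iff.1 hSl⟩)
    · exact absurd (antipode_gr_eq_id_of_pow_odd ⟨m, rfl⟩ hSl) hS
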